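/- By a unit-area pentagon we mean a simple (not necessarily convex) pentagon in the Euclidean plane that encloses area $1$. A unit-area pentagon is called efficient if its perimeter is at most $2\sqrt{2+\sqrt3}\approx 3.8637$, the perimeter of the unit-area Cairo pentagon. (1) Let $e>0$. Among all unit-area pentagons that have an edge of length $e$ there is one of least perimeter. A unit-area pentagon with a given edge $E$ of length $e$ is such a perimeter minimizer if and only if it is inscribed in a circle and its four edges other than $E$ have equal lengths. The minimizer is unique up to congruence: if $P$ and $Q$ are minimizers with vertices listed consecutively as $P_0,\dots,P_4$ and $Q_0,\dots,Q_4$, so that $|P_0P_1|=|Q_0Q_1|=e$, then $|P_aP_b|=|Q_aQ_b|$ for all $a,b$. (2) Every edge of an efficient pentagon has length strictly between $0.3928$ and $1.092$. Every edge of a unit-area pentagon with perimeter at most $3.86$ has length strictly between $0.4073$ and $1.081$. -/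

import Mathlib

open MeasureTheory

noncomputable section

/-- The Euclidean plane. -/
abbrev Plane : Type := EuclideanSpace ℝ (Fin 2)

namespace Polygon

variable {n : ℕ}

/-- The length of the `i`-th edge, which joins vertex `i` to the cyclically next vertex. -/
def edgeLength (p : Polygon Plane n) (i : Fin n) : ℝ :=
  dist (p i) (p (finRotate n i))

/-- The perimeter: the sum of all edge lengths. -/
def perimeter (p : Polygon Plane n) : ℝ :=
  ∑ i, p.edgeLength i

/-- A closed polygon (with at least three vertices) is simple if its vertices are distinct and two
different edges meet at most in a common endpoint. Convexity is not required. -/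
def IsSimple (p : Polygon Plane n) : Prop :=
  Function.Injective p.vertices ∧
    ∀ i j : Fin n, i ≠ j →
      p.edgeSet ℝ i ∩ p.edgeSet ℝ j ⊆
        ({p i, p (finRotate n i)} ∩ {p j, p (finRotate n j)} : Set Plane)

/-- The region enclosed by the polygon: the union of the bounded connected components of the
complement of its boundary. -/
def enclosedRegion (p : Polygon Plane n) : Set Plane :=
  {x | x ∉ p.boundary ℝ ∧
    Bornology.IsBounded (connectedComponentIn (p.boundary ℝ)ᶜ x)}

/-- The area: the two-dimensional Lebesgue measure of the enclosed region. -/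
def area (p : Polygon Plane n) : ENNReal :=
  volume p.enclosedRegion

end Polygon

/-- A unit-area pentagon: a simple, not necessarily convex, pentagon of area one. -/
def IsUnitPentagon (p : Polygon Plane 5) : Prop :=
  p.IsSimple ∧ p.area = 1

/-- `p` has least perimeter among the unit-area pentagons that have an edge of length `e`. -/
def IsPerimeterMinimizer (e : ℝ) (p : Polygon Plane 5) : Prop :=
  (IsUnitPentagon p ∧ ∃ i, p.edgeLength i = e) ∧
    ∀ q : Polygon Plane 5, IsUnitPentagon q → (∃ j, q.edgeLength j = e) →
      p.perimeter ≤ q.perimeter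

/-- An efficient pentagon: a unit-area pentagon whose perimeter is at most `2√(2 + √3)`, the
perimeter of a unit-area Cairo pentagon. -/
def IsEfficientPentagon (p : Polygon Plane 5) : Prop :=
  IsUnitPentagon p ∧ p.perimeter ≤ 2 * √(2 + √3)

end

/-! Fix an edge of length `e`. The other four edges form a path `u 0, …, u 4` in ℂ with chord `u 4 -
u 0`. The crux is a family of isoperimetric inequalities: for every `0 < t < 1`, `len² ≥ 16 t · area
+ 4 c(t) · |chord|²` with `c = Arc.chordCoeff` (`Arc.len_sq_ge`). With `t = tan θ` one has `c(t) =
tan θ cot 4θ`. Equality holds exactly for the path of four equal chords of a circle, each of central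
angle `2θ`; the condition `t < 1` says that four such steps do not go once around.

For the energy (the sum of squared edge lengths) in place of `len² / 4`, the inequality is an
identity with three squares, obtained by completing squares one vertex at a time (`Arc.energy_eq`).
Cauchy–Schwarz gives `len² ≤ 4 · energy`, the wrong direction for a bound on length, so the path is
first replaced by an equilateral one, where `len² = 4 · energy` (`Arc.exists_equilateral`). In the
case of equality the path is already equilateral, since otherwise it could be improved
(`Arc.eq_extremal_of_len_sq_le`).

For a unit-area pentagon the bound on `perimeter - e` depends on `e` and `t` only. Hence a pentagon
that is extremal for some `t` is a minimizer for its edge. A suitable `t` exists for every `e` by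
the intermediate value theorem, and the resulting convex pentagon is simple, so every minimizer is
extremal with this same `t`, and `e` and `t` determine all distances. Conversely, five points on a
circle with four equal steps form a path `c + ω ^ k v`, and simplicity excludes paths that wrap
around the circle (`Arc.isExtremal_or_conj`). The bounds of part (2) come from a few fixed values of
`t`, each of which gives a quadratic inequality in `e`.

All this needs the area of a simple pentagon, defined through bounded components, to be the absolute
value of the shoelace sum (`IsSimple.area_eq`). This rests on the Jordan curve theorem for polygons,
proved with the winding number as a count of ray crossings (`exists_winding_sign`). -/

noncomputable section

open Filter Topology

/-! ### Signed crossings of a vertical ray with a segment -/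

namespace Plane

/-- Twice the signed area of the triangle `a b x`; positive when `x` lies to the left of `ab`. -/
def cross (a b x : Plane) : ℝ :=
  (b 0 - a 0) * (x 1 - a 1) - (b 1 - a 1) * (x 0 - a 0)

/-- The points strictly below the segment `ab`, when `a` is to the left of `b`. -/
def below (a b : Plane) : Set Plane :=
  {x | a 0 ≤ x 0 ∧ x 0 < b 0 ∧ cross a b x < 0}

open Classical in
/-- The signed number of crossings of the upward vertical ray from `x` with the segment `ab`. -/
def crossing (a b x : Plane) : ℤ :=
  (if x ∈ below b a then 1 else 0) - (if x ∈ below a b then 1 else 0)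

/-- A correction term that accounts for the ray from `x` passing through the vertex `a`. -/
def vertexTerm (a x y : Plane) : ℤ :=
  if a 0 = x 0 ∧ x 1 < a 1 ∧ a 0 ≤ y 0 then 1 else 0

lemma crossing_swap (a b x : Plane) : crossing b a x = - crossing a b x := by
  simp [crossing]

lemma cross_swap (a b x : Plane) : cross b a x = - cross a b x := by
  simp only [cross]; ring

lemma continuous_coord (i : Fin 2) : Continuous fun x : Plane => x i := by fun_prop

lemma continuous_cross (a b : Plane) : Continuous (cross a b) := by
  unfold cross; fun_prop

lemma mem_affineSegment_iff {a b x : Plane} :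
    x ∈ affineSegment ℝ a b ↔
      ∃ t ∈ Set.Icc (0 : ℝ) 1, x 0 = a 0 + t * (b 0 - a 0) ∧ x 1 = a 1 + t * (b 1 - a 1) := by
  constructor
  · rintro ⟨t, ht, rfl⟩
    refine ⟨t, ht, ?_, ?_⟩ <;> simp [AffineMap.lineMap_apply] <;> ring
  · rintro ⟨t, ht, h0, h1⟩
    refine ⟨t, ht, ?_⟩
    ext i
    fin_cases i
    · simp [AffineMap.lineMap_apply, h0]; ring
    · simp [AffineMap.lineMap_apply, h1]; ring

lemma ext_coord {x y : Plane} (h0 : x 0 = y 0) (h1 : x 1 = y 1) : x = y := by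
  ext i; fin_cases i <;> assumption

/-- Off the segment `ab` the corrected crossing number is locally constant. -/
lemma crossing_locally_const_of_lt {a b x : Plane} (hab : a 0 < b 0)
    (hx : x ∉ affineSegment ℝ a b) :
    ∃ k : ℤ, ∀ᶠ y in 𝓝 x, crossing a b y + vertexTerm a x y - vertexTerm b x y = k := by
  have c0 := (continuous_coord 0).continuousAt (x := x)
  have cc := (continuous_cross a b).continuousAt (x := x)
  rcases lt_trichotomy (x 0) (a 0) with h | h | h
  · refine ⟨0, ?_⟩
    filter_upwards [c0.eventually_lt_const h] with y hy
    simp only [crossing, below, vertexTerm, Set.mem_ofPred_eq]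
    grind
  · rcases lt_trichotomy (x 1) (a 1) with h1 | h1 | h1
    · refine ⟨0, ?_⟩
      have hc : cross a b x < 0 := by simp only [cross]; rw [h]; nlinarith
      filter_upwards [c0.eventually_lt_const (h ▸ hab : x 0 < b 0),
        cc.eventually_lt_const hc] with y hy hy'
      simp only [crossing, below, vertexTerm, Set.mem_ofPred_eq]
      grind
    · exact absurd (by rw [ext_coord h h1]; exact left_mem_affineSegment ℝ a b) hx
    · refine ⟨0, ?_⟩
      have hc : 0 < cross a b x := by simp only [cross]; rw [h]; nlinarith
      filter_upwards [c0.eventually_lt_const (h ▸ hab : x 0 < b 0),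
        cc.eventually_const_lt hc] with y hy hy'
      simp only [crossing, below, vertexTerm, Set.mem_ofPred_eq]
      grind
  · rcases lt_trichotomy (x 0) (b 0) with h' | h' | h'
    · rcases lt_trichotomy (cross a b x) 0 with h1 | h1 | h1
      · refine ⟨-1, ?_⟩
        filter_upwards [c0.eventually_lt_const h', c0.eventually_const_lt h,
          cc.eventually_lt_const h1] with y hy hy' hy''
        simp only [crossing, below, vertexTerm, Set.mem_ofPred_eq]
        grind
      · refine absurd (mem_affineSegment_iff.2 ⟨(x 0 - a 0) / (b 0 - a 0), ⟨?_, ?_⟩, ?_, ?_⟩) hx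
        · exact div_nonneg (by linarith) (by linarith)
        · rw [div_le_one (by linarith)]; linarith
        · have : b 0 - a 0 ≠ 0 := by linarith
          field_simp; ring
        · have : b 0 - a 0 ≠ 0 := by linarith
          simp only [cross] at h1
          field_simp; linarith
      · refine ⟨0, ?_⟩
        filter_upwards [c0.eventually_lt_const h', c0.eventually_const_lt h,
          cc.eventually_const_lt h1] with y hy hy' hy''
        simp only [crossing, below, vertexTerm, Set.mem_ofPred_eq]
        grind
    · have hce : cross a b x = (b 0 - a 0) * (x 1 - b 1) := by simp only [cross]; rw [h']; ring
      rcases lt_trichotomy (x 1) (b 1) with h1 | h1 | h1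
      · refine ⟨-1, ?_⟩
        have hc : cross a b x < 0 := by rw [hce]; nlinarith
        filter_upwards [c0.eventually_const_lt h, cc.eventually_lt_const hc] with y hy hy'
        simp only [crossing, below, vertexTerm, Set.mem_ofPred_eq]
        grind
      · exact absurd (by rw [ext_coord h' h1]; exact right_mem_affineSegment ℝ a b) hx
      · refine ⟨0, ?_⟩
        have hc : 0 < cross a b x := by rw [hce]; nlinarith
        filter_upwards [c0.eventually_const_lt h, cc.eventually_const_lt hc] with y hy hy'
        simp only [crossing, below, vertexTerm, Set.mem_ofPred_eq]
        grind
    · refine ⟨0, ?_⟩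
      filter_upwards [c0.eventually_const_lt h'] with y hy
      simp only [crossing, below, vertexTerm, Set.mem_ofPred_eq]
      grind

/-- The bare count jumps when the ray passes an endpoint. The correction depends on one vertex at a
time and enters with opposite signs for the two ends of an edge, so it cancels around a closed
polygon. -/
lemma crossing_locally_const {a b x : Plane} (hx : x ∉ affineSegment ℝ a b) :
    ∃ k : ℤ, ∀ᶠ y in 𝓝 x, crossing a b y + vertexTerm a x y - vertexTerm b x y = k := by
  rcases lt_trichotomy (a 0) (b 0) with h | h | h
  · exact crossing_locally_const_of_lt h hx
  · refine ⟨0, Eventually.of_forall fun y => ?_⟩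
    by_cases hx0 : x 0 = a 0
    · have key : (x 1 < a 1 ↔ x 1 < b 1) := by
        by_contra hne
        have hab : a 1 - b 1 ≠ 0 := by grind
        refine hx (mem_affineSegment_iff.2 ⟨(x 1 - a 1) / (b 1 - a 1), ?_, ?_, ?_⟩)
        · rcases lt_or_ge (a 1) (b 1) with h2 | h2
          · exact ⟨div_nonneg (by grind) (by grind), by rw [div_le_one (by linarith)]; grind⟩
          · exact ⟨div_nonneg_of_nonpos (by grind) (by grind),
              by rw [div_le_one_of_neg (by grind)]; grind⟩
        · rw [h, sub_self, mul_zero, add_zero, hx0, h]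
        · have : b 1 - a 1 ≠ 0 := by grind
          field_simp; ring
      simp only [crossing, below, vertexTerm, Set.mem_ofPred_eq]
      grind
    · simp only [crossing, below, vertexTerm, Set.mem_ofPred_eq]
      grind
  · obtain ⟨k, hk⟩ := crossing_locally_const_of_lt h
      (by rwa [affineSegment_comm] : x ∉ affineSegment ℝ b a)
    refine ⟨-k, hk.mono fun y hy => ?_⟩
    rw [crossing_swap b a, ← hy]; ring

/-- Near an interior point of the segment `ab` the corrected crossing number is one larger on the
left of the segment than on its right. -/
lemma crossing_jump {a b z : Plane} (hab : a ≠ b) {t : ℝ} (ht : 0 < t) (ht1 : t < 1)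
    (h0 : z 0 = a 0 + t * (b 0 - a 0)) (h1 : z 1 = a 1 + t * (b 1 - a 1)) :
    ∃ k : ℤ, ∀ᶠ y in 𝓝 z, cross a b y ≠ 0 →
      crossing a b y + vertexTerm a z y - vertexTerm b z y =
        k + if 0 < cross a b y then 1 else 0 := by
  have c0 := (continuous_coord 0).continuousAt (x := z)
  rcases lt_trichotomy (a 0) (b 0) with h | h | h
  · have e1 : a 0 < z 0 := by nlinarith
    have e2 : z 0 < b 0 := by nlinarith
    refine ⟨-1, ?_⟩
    filter_upwards [c0.eventually_const_lt e1, c0.eventually_lt_const e2] with y hy hy' hc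
    simp only [crossing, below, vertexTerm, Set.mem_ofPred_eq, cross_swap a b]
    grind
  -- A vertical edge is never counted by `crossing`. The whole jump comes from the `vertexTerm` of
  -- the upper endpoint, which lies straight above `z`.
  · have hz0 : z 0 = a 0 := by rw [h0, h]; ring
    have hcr : ∀ y, cross a b y = (b 1 - a 1) * (a 0 - y 0) := fun y => by
      simp only [cross]; rw [h]; ring
    rcases lt_trichotomy (a 1) (b 1) with h' | h' | h'
    · refine ⟨-1, Eventually.of_forall fun y hc => ?_⟩
      have : 0 < cross a b y ↔ y 0 < a 0 := by
        rw [hcr, mul_pos_iff_of_pos_left (by linarith)]; constructor <;> intro <;> linarith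
      have e1 : a 1 < z 1 := by nlinarith
      have e2 : z 1 < b 1 := by nlinarith
      simp only [this]
      simp only [crossing, below, vertexTerm, Set.mem_ofPred_eq]
      grind
    · exact absurd (ext_coord h h') hab
    · refine ⟨0, Eventually.of_forall fun y hc => ?_⟩
      have : 0 < cross a b y ↔ a 0 < y 0 := by
        rw [hcr, mul_pos_iff]; constructor
        · rintro (⟨_, _⟩ | ⟨_, _⟩) <;> linarith
        · intro; right; constructor <;> linarith
      have hne : y 0 ≠ a 0 := by
        intro h2; apply hc; rw [hcr, h2]; ring
      have e1 : z 1 < a 1 := by nlinarith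
      have e2 : b 1 < z 1 := by nlinarith
      simp only [this]
      simp only [crossing, below, vertexTerm, Set.mem_ofPred_eq]
      grind
  · have e1 : b 0 < z 0 := by nlinarith
    have e2 : z 0 < a 0 := by nlinarith
    refine ⟨0, ?_⟩
    filter_upwards [c0.eventually_const_lt e1, c0.eventually_lt_const e2] with y hy hy' hc
    simp only [crossing, below, vertexTerm, Set.mem_ofPred_eq, cross_swap a b]
    grind

end Plane

/-! ### The two local sides of a segment and of a corner -/

namespace Plane

lemma cross_comb (a b x y : Plane) {s t : ℝ} (h : s + t = 1) :
    cross a b (s • x + t • y) = s * cross a b x + t * cross a b y := by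
  obtain rfl : t = 1 - s := by linarith
  simp [cross]; ring

lemma convex_cross_pos (a b : Plane) : Convex ℝ {y | 0 < cross a b y} := by
  intro x hx y hy s t hs ht hst
  simp only [Set.mem_ofPred_eq] at *
  rw [cross_comb a b x y hst]
  rcases hs.eq_or_lt with rfl | hs
  · obtain rfl : t = 1 := by linarith
    simpa using hy
  · have := mul_pos hs hx
    have := mul_nonneg ht hy.le
    linarith

lemma convex_cross_neg (a b : Plane) : Convex ℝ {y | cross a b y < 0} := by
  have := convex_cross_pos b a
  simpa [cross_swap a b] using this

lemma isOpen_cross_pos (a b : Plane) : IsOpen {y | 0 < cross a b y} :=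
  isOpen_lt continuous_const (continuous_cross a b)

lemma normSq_pos {a b : Plane} (hab : a ≠ b) : 0 < (b 0 - a 0) ^ 2 + (b 1 - a 1) ^ 2 := by
  by_contra h
  have h0 := sq_nonneg (b 0 - a 0)
  have h1 := sq_nonneg (b 1 - a 1)
  have e0 : b 0 - a 0 = 0 := by apply pow_eq_zero_iff (two_ne_zero) |>.1; linarith
  have e1 : b 1 - a 1 = 0 := by apply pow_eq_zero_iff (two_ne_zero) |>.1; linarith
  exact hab (ext_coord (by linarith) (by linarith))

lemma mem_closure_of_direction {s : Set Plane} {z : Plane} (d : Plane)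
    (h : ∀ δ : ℝ, 0 < δ → z + δ • d ∈ s) : z ∈ closure s := by
  have hc : Tendsto (fun δ : ℝ => z + δ • d) (𝓝[>] 0) (𝓝 z) := by
    have : Continuous fun δ : ℝ => z + δ • d := by fun_prop
    have h2 := this.tendsto 0
    simp only [zero_smul, add_zero] at h2
    exact h2.mono_left nhdsWithin_le_nhds
  exact mem_closure_of_tendsto hc (eventually_mem_nhdsWithin.mono fun δ hδ => h δ hδ)

lemma mem_closure_cross_pos {a b z : Plane} (hab : a ≠ b) (hz : cross a b z = 0) :
    z ∈ closure {y | 0 < cross a b y} := by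
  refine mem_closure_of_direction !₂[-(b 1 - a 1), b 0 - a 0] fun δ hδ => ?_
  have e : cross a b (z + δ • !₂[-(b 1 - a 1), b 0 - a 0]) =
      cross a b z + δ * ((b 0 - a 0) ^ 2 + (b 1 - a 1) ^ 2) := by
    simp [cross]; ring
  rw [Set.mem_ofPred_eq, e, hz, zero_add]
  exact mul_pos hδ (normSq_pos hab)

lemma mem_closure_cross_neg {a b z : Plane} (hab : a ≠ b) (hz : cross a b z = 0) :
    z ∈ closure {y | cross a b y < 0} := by
  have := mem_closure_cross_pos hab.symm (z := z) (by rw [cross_swap, hz, neg_zero])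
  simpa [cross_swap a b] using this

lemma cross_eq_zero_of_mem {a b y : Plane} (h : y ∈ affineSegment ℝ a b) : cross a b y = 0 := by
  obtain ⟨t, -, h0, h1⟩ := mem_affineSegment_iff.1 h
  simp only [cross, h0, h1]; ring

/-- The scalar product of `b - a` and `y - a`. -/
def dotp (a b y : Plane) : ℝ := (b 0 - a 0) * (y 0 - a 0) + (b 1 - a 1) * (y 1 - a 1)

lemma continuous_dotp (a b : Plane) : Continuous (dotp a b) := by
  unfold dotp; fun_prop

lemma mem_affineSegment_of_cross_eq_zero {a b y : Plane} (hab : a ≠ b) (h : cross a b y = 0)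
    (h0 : 0 ≤ dotp a b y) (h1 : dotp a b y ≤ (b 0 - a 0) ^ 2 + (b 1 - a 1) ^ 2) :
    y ∈ affineSegment ℝ a b := by
  have hn := normSq_pos hab
  refine mem_affineSegment_iff.2 ⟨dotp a b y / ((b 0 - a 0) ^ 2 + (b 1 - a 1) ^ 2),
    ⟨div_nonneg h0 hn.le, (div_le_one hn).2 h1⟩, ?_, ?_⟩
  · simp only [cross] at h
    rw [div_mul_eq_mul_div, ← sub_eq_iff_eq_add', eq_div_iff hn.ne']
    simp only [dotp]; linear_combination -(b 1 - a 1) * h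
  · simp only [cross] at h
    rw [div_mul_eq_mul_div, ← sub_eq_iff_eq_add', eq_div_iff hn.ne']
    simp only [dotp]; linear_combination (b 0 - a 0) * h

lemma isClosed_affineSegment (a b : Plane) : IsClosed (affineSegment ℝ a b) := by
  have : IsCompact (affineSegment ℝ a b) :=
    isCompact_Icc.image (AffineMap.lineMap_continuous)
  exact this.isClosed

/-- Every small disc about `z` is cut by `Γ` into two connected sets, each of which accumulates at
all points of `Γ` in that disc. -/
def IsTwoSided (Γ : Set Plane) (z : Plane) : Prop :=
  ∀ᶠ r in 𝓝[>] (0 : ℝ), ∃ A B : Set Plane, IsPreconnected A ∧ IsPreconnected B ∧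
    A ∪ B = Metric.ball z r \ Γ ∧ ∀ y ∈ Metric.ball z r ∩ Γ, y ∈ closure A ∧ y ∈ closure B

lemma eventually_ball {P : Plane → Prop} {z : Plane} (h : ∀ᶠ y in 𝓝 z, P y) :
    ∀ᶠ r in 𝓝[>] (0 : ℝ), ∀ y ∈ Metric.ball z r, P y := by
  obtain ⟨r, hr, h⟩ := Metric.eventually_nhds_iff_ball.1 h
  filter_upwards [Ioo_mem_nhdsGT hr] with r' hr' y hy
  exact h y (Metric.ball_subset_ball hr'.2.le hy)

lemma IsTwoSided.congr {Γ Γ' : Set Plane} {z : Plane} (h : IsTwoSided Γ z)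
    (he : ∀ᶠ y in 𝓝 z, y ∈ Γ ↔ y ∈ Γ') : IsTwoSided Γ' z := by
  filter_upwards [h, eventually_ball he] with r ⟨A, B, hA, hB, hu, hc⟩ hr
  refine ⟨A, B, hA, hB, ?_, fun y hy => hc y ⟨hy.1, (hr y hy.1).2 hy.2⟩⟩
  rw [hu]; ext y
  simp only [Set.mem_sdiff]
  exact ⟨fun hy => ⟨hy.1, fun h => hy.2 ((hr y hy.1).2 h)⟩,
    fun hy => ⟨hy.1, fun h => hy.2 ((hr y hy.1).1 h)⟩⟩

lemma isTwoSided_segment {a b z : Plane} (hab : a ≠ b) {t : ℝ} (ht : 0 < t) (ht1 : t < 1)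
    (h0 : z 0 = a 0 + t * (b 0 - a 0)) (h1 : z 1 = a 1 + t * (b 1 - a 1)) :
    IsTwoSided (affineSegment ℝ a b) z := by
  have hn := normSq_pos hab
  have hd : dotp a b z = t * ((b 0 - a 0) ^ 2 + (b 1 - a 1) ^ 2) := by
    simp only [dotp, h0, h1]; ring
  have e0 : 0 < dotp a b z := by rw [hd]; positivity
  have e1 : dotp a b z < (b 0 - a 0) ^ 2 + (b 1 - a 1) ^ 2 := by rw [hd]; nlinarith
  have hcd := (continuous_dotp a b).continuousAt (x := z)
  filter_upwards [eventually_ball ((hcd.eventually_const_lt e0).and (hcd.eventually_lt_const e1))]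
    with r hr
  have key : ∀ y ∈ Metric.ball z r, (y ∈ affineSegment ℝ a b ↔ cross a b y = 0) := fun y hy =>
    ⟨cross_eq_zero_of_mem, fun h =>
      mem_affineSegment_of_cross_eq_zero hab h (hr y hy).1.le (hr y hy).2.le⟩
  refine ⟨Metric.ball z r ∩ {y | 0 < cross a b y}, Metric.ball z r ∩ {y | cross a b y < 0},
    ((convex_ball z r).inter (convex_cross_pos a b)).isPreconnected,
    ((convex_ball z r).inter (convex_cross_neg a b)).isPreconnected, ?_, fun y hy => ?_⟩
  · ext y
    simp only [Set.mem_union, Set.mem_inter_iff, Set.mem_ofPred_eq, Set.mem_sdiff]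
    constructor
    · rintro (⟨hy, h⟩ | ⟨hy, h⟩)
      · exact ⟨hy, fun h' => h.ne' ((key y hy).1 h')⟩
      · exact ⟨hy, fun h' => h.ne ((key y hy).1 h')⟩
    · rintro ⟨hy, h⟩
      rcases lt_or_gt_of_ne (fun h' => h ((key y hy).2 h')) with h | h
      · exact Or.inr ⟨hy, h⟩
      · exact Or.inl ⟨hy, h⟩
  · have hy0 := (key y hy.1).1 hy.2
    exact ⟨Metric.isOpen_ball.inter_closure ⟨hy.1, mem_closure_cross_pos hab hy0⟩,
      Metric.isOpen_ball.inter_closure ⟨hy.1, mem_closure_cross_neg hab hy0⟩⟩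

lemma isTwoSided_corner_of_pos {a z b : Plane} (h : 0 < cross a z b) :
    IsTwoSided (affineSegment ℝ a z ∪ affineSegment ℝ z b) z := by
  have haz : a ≠ z := by rintro rfl; simp [cross] at h
  have hzb : z ≠ b := by rintro rfl; simp only [cross] at h; linarith
  have hn := normSq_pos haz
  have hn' := normSq_pos hzb
  have e0 : 0 < dotp a z z := by simp only [dotp]; nlinarith
  have e1 : dotp z b z < (b 0 - z 0) ^ 2 + (b 1 - z 1) ^ 2 := by simp only [dotp]; nlinarith
  -- The radius is so small that points of the disc project onto the lines `az` and `zb` away from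
  -- the far ends `a` and `b`. Inside the disc both edges look like rays from `z`. The two sides are
  -- the convex sector `P ∩ P'` and the reflex sector `N ∪ N'`.
  filter_upwards [eventually_mem_nhdsWithin, eventually_ball
    (((continuous_dotp a z).continuousAt.eventually_const_lt e0).and
    ((continuous_dotp z b).continuousAt.eventually_lt_const e1))] with r hr0 hr
  have hzr : z ∈ Metric.ball z r := Metric.mem_ball_self hr0
  set P := {y | 0 < cross a z y} with hP
  set N := {y | cross a z y < 0} with hN
  set P' := {y | 0 < cross z b y} with hP'
  set N' := {y | cross z b y < 0} with hN'
  have hzN : ∀ y ∈ Metric.ball z r, cross a z y = 0 →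
      y ∈ closure (Metric.ball z r ∩ (N ∪ N')) := fun y hy h0 =>
    closure_mono (Set.inter_subset_inter_right _ Set.subset_union_left)
      (Metric.isOpen_ball.inter_closure ⟨hy, mem_closure_cross_neg haz h0⟩)
  have hzN' : ∀ y ∈ Metric.ball z r, cross z b y = 0 →
      y ∈ closure (Metric.ball z r ∩ (N ∪ N')) := fun y hy h0 =>
    closure_mono (Set.inter_subset_inter_right _ Set.subset_union_right)
      (Metric.isOpen_ball.inter_closure ⟨hy, mem_closure_cross_neg hzb h0⟩)
  have hzP : z ∈ closure (Metric.ball z r ∩ (P ∩ P')) := by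
    refine Metric.isOpen_ball.inter_closure
      -- The direction `(a - z) + (b - z)` points into the convex sector.
      ⟨hzr, mem_closure_of_direction (a + b - (2 : ℝ) • z) fun δ hδ => ?_⟩
    have i1 : cross a z (z + δ • (a + b - (2 : ℝ) • z)) = δ * cross a z b := by
      simp [cross]; ring
    have i2 : cross z b (z + δ • (a + b - (2 : ℝ) • z)) = δ * cross a z b := by
      simp [cross]; ring
    exact ⟨by rw [hP, Set.mem_ofPred_eq, i1]; positivity,
      by rw [hP', Set.mem_ofPred_eq, i2]; positivity⟩
  have hseg : ∀ y ∈ affineSegment ℝ a z, cross a z y = 0 ∧ 0 ≤ cross z b y ∧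
      (y ≠ z → 0 < cross z b y) := fun y hy => by
    refine ⟨cross_eq_zero_of_mem hy, ?_⟩
    obtain ⟨t, ht, h0, h1⟩ := mem_affineSegment_iff.1 hy
    have e : cross z b y = (1 - t) * cross a z b := by
      simp only [cross, h0, h1]; ring
    rw [e]
    refine ⟨mul_nonneg (by linarith [ht.2]) h.le, fun hne => mul_pos ?_ h⟩
    rcases ht.2.eq_or_lt with rfl | h'
    · exact absurd (ext_coord (by rw [h0]; ring) (by rw [h1]; ring)) hne
    · linarith
  have hseg' : ∀ y ∈ affineSegment ℝ z b, cross z b y = 0 ∧ 0 ≤ cross a z y ∧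
      (y ≠ z → 0 < cross a z y) := fun y hy => by
    refine ⟨cross_eq_zero_of_mem hy, ?_⟩
    obtain ⟨t, ht, h0, h1⟩ := mem_affineSegment_iff.1 hy
    have e : cross a z y = t * cross a z b := by
      simp only [cross, h0, h1]; ring
    rw [e]
    refine ⟨mul_nonneg ht.1 h.le, fun hne => mul_pos ?_ h⟩
    rcases ht.1.eq_or_lt with rfl | h'
    · exact absurd (ext_coord (by rw [h0]; ring) (by rw [h1]; ring)) hne
    · exact h'
  refine ⟨Metric.ball z r ∩ (P ∩ P'), Metric.ball z r ∩ (N ∪ N'),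
    ((convex_ball z r).inter ((convex_cross_pos a z).inter (convex_cross_pos z b))).isPreconnected,
    ?_, ?_, ?_⟩
  · rw [Set.inter_union_distrib_left]
    refine IsPreconnected.union' ?_
      ((convex_ball z r).inter (convex_cross_neg a z)).isPreconnected
      ((convex_ball z r).inter (convex_cross_neg z b)).isPreconnected
    -- The reflex sector is a union of two convex sets; a common point, found opposite to the convex
    -- sector, makes it connected.
    have hcl : z ∈ closure (N ∩ N') := by
      refine mem_closure_of_direction ((2 : ℝ) • z - a - b) fun δ hδ => ?_
      have i1 : cross a z (z + δ • ((2 : ℝ) • z - a - b)) = - (δ * cross a z b) := by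
        simp [cross]; ring
      have i2 : cross z b (z + δ • ((2 : ℝ) • z - a - b)) = - (δ * cross a z b) := by
        simp [cross]; ring
      exact ⟨by rw [hN, Set.mem_ofPred_eq, i1]; simp; positivity,
        by rw [hN', Set.mem_ofPred_eq, i2]; simp; positivity⟩
    obtain ⟨y, hy, hy'⟩ := mem_closure_iff.1 hcl _ Metric.isOpen_ball hzr
    exact ⟨y, ⟨hy, hy'.1⟩, hy, hy'.2⟩
  · ext y
    simp only [Set.mem_union, Set.mem_inter_iff, Set.mem_sdiff]
    constructor
    · rintro (⟨hy, h1, h2⟩ | ⟨hy, h1 | h1⟩) <;> refine ⟨hy, ?_⟩ <;> rintro (h' | h')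
      · exact (hseg y h').1.not_gt h1
      · exact (hseg' y h').1.not_gt h2
      · exact (hseg y h').1.not_lt h1
      · exact (hseg' y h').2.1.not_gt h1
      · exact (hseg y h').2.1.not_gt h1
      · exact (hseg' y h').1.not_lt h1
    · rintro ⟨hy, hns⟩
      by_contra hcon
      have hcon : ¬ (0 < cross a z y ∧ 0 < cross z b y) ∧
          ¬ (cross a z y < 0 ∨ cross z b y < 0) := by
        constructor
        · exact fun h' => hcon (Or.inl ⟨hy, h'⟩)
        · exact fun h' => hcon (Or.inr ⟨hy, h'⟩)
      have hα : 0 ≤ cross a z y := by by_contra! h'; exact hcon.2 (Or.inl h')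
      have hβ : 0 ≤ cross z b y := by by_contra! h'; exact hcon.2 (Or.inr h')
      by_cases hα0 : cross a z y = 0
      · refine hns (Or.inl (mem_affineSegment_of_cross_eq_zero haz hα0 (hr y hy).1.le ?_))
        have id1 : cross z b y * ((z 0 - a 0) ^ 2 + (z 1 - a 1) ^ 2) =
            - (dotp a z y - ((z 0 - a 0) ^ 2 + (z 1 - a 1) ^ 2)) * cross a z b +
            cross a z y * ((z 0 - a 0) * (b 0 - z 0) + (z 1 - a 1) * (b 1 - z 1)) := by
          simp only [cross, dotp]; ring
        rw [hα0, zero_mul, add_zero] at id1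
        by_contra! hlt
        nlinarith [mul_nonneg hβ hn.le, mul_pos (sub_pos.2 hlt) h]
      · have hβ0 : cross z b y = 0 := by
          by_contra h'
          exact hcon.1 ⟨lt_of_le_of_ne hα (Ne.symm hα0), lt_of_le_of_ne hβ (Ne.symm h')⟩
        refine hns (Or.inr (mem_affineSegment_of_cross_eq_zero hzb hβ0 ?_ (hr y hy).2.le))
        have id1 : cross a z y * ((b 0 - z 0) ^ 2 + (b 1 - z 1) ^ 2) =
            dotp z b y * cross a z b +
            cross z b y * ((z 0 - a 0) * (b 0 - z 0) + (z 1 - a 1) * (b 1 - z 1)) := by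
          simp only [cross, dotp]; ring
        rw [hβ0, zero_mul, add_zero] at id1
        by_contra! hlt
        nlinarith [mul_nonneg hα hn'.le, mul_pos (neg_pos.2 hlt) h]
  · rintro y ⟨hy, h' | h'⟩
    · obtain ⟨h0, -, h2⟩ := hseg y h'
      refine ⟨?_, hzN y hy h0⟩
      by_cases hyz : y = z
      · rwa [hyz]
      · rw [Set.inter_comm P P', ← Set.inter_assoc]
        exact (Metric.isOpen_ball.inter (isOpen_cross_pos z b)).inter_closure
          ⟨⟨hy, h2 hyz⟩, mem_closure_cross_pos haz h0⟩
    · obtain ⟨h0, -, h2⟩ := hseg' y h'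
      refine ⟨?_, hzN' y hy h0⟩
      by_cases hyz : y = z
      · rwa [hyz]
      · rw [← Set.inter_assoc]
        exact (Metric.isOpen_ball.inter (isOpen_cross_pos a z)).inter_closure
          ⟨⟨hy, h2 hyz⟩, mem_closure_cross_pos hzb h0⟩

lemma affineSegment_union_of_mem {a z b : Plane} {t : ℝ} (ht0 : 0 < t) (ht1 : t < 1)
    (g0 : z 0 = a 0 + t * (b 0 - a 0)) (g1 : z 1 = a 1 + t * (b 1 - a 1)) :
    affineSegment ℝ a z ∪ affineSegment ℝ z b = affineSegment ℝ a b := by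
  ext y
  simp only [Set.mem_union, mem_affineSegment_iff]
  constructor
  · rintro (⟨s, hs, h0, h1⟩ | ⟨s, hs, h0, h1⟩)
    · exact ⟨s * t, ⟨mul_nonneg hs.1 ht0.le, mul_le_one₀ hs.2 ht0.le ht1.le⟩,
        by rw [h0, g0]; ring, by rw [h1, g1]; ring⟩
    · have := mul_nonneg hs.1 (sub_nonneg.2 ht1.le)
      have := mul_nonneg (sub_nonneg.2 hs.2) (sub_nonneg.2 ht1.le)
      exact ⟨t + s * (1 - t), ⟨by linarith, by linarith⟩, by rw [h0, g0]; ring,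
        by rw [h1, g1]; ring⟩
  · rintro ⟨s, hs, h0, h1⟩
    rcases le_total s t with hst | hst
    · refine Or.inl ⟨s / t, ⟨div_nonneg hs.1 ht0.le, (div_le_one ht0).2 hst⟩, ?_, ?_⟩
      · rw [h0, g0]; field_simp; ring
      · rw [h1, g1]; field_simp; ring
    · have h1t : 0 < 1 - t := by linarith
      refine Or.inr ⟨(s - t) / (1 - t), ⟨div_nonneg (by linarith) h1t.le,
        (div_le_one h1t).2 (by linarith [hs.2])⟩, ?_, ?_⟩
      · rw [h0, g0]; field_simp; ring
      · rw [h1, g1]; field_simp; ring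

/-- A right turn is a left turn traversed backwards. If the three points are collinear, two edges
that share only `z` cannot fold back, so `z` is an inner point of the segment `ab`. -/
lemma isTwoSided_corner {a z b : Plane} (haz : a ≠ z) (hzb : z ≠ b)
    (h : affineSegment ℝ a z ∩ affineSegment ℝ z b ⊆ {z}) :
    IsTwoSided (affineSegment ℝ a z ∪ affineSegment ℝ z b) z := by
  rcases lt_trichotomy (cross a z b) 0 with hτ | hτ | hτ
  · have : 0 < cross b z a := by simp only [cross] at *; linarith
    have := isTwoSided_corner_of_pos this
    rwa [affineSegment_comm ℝ b z, affineSegment_comm ℝ z a, Set.union_comm] at this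
  · have hn := normSq_pos haz
    have hn' := normSq_pos hzb
    set u0 := z 0 - a 0
    set u1 := z 1 - a 1
    set v0 := b 0 - z 0
    set v1 := b 1 - z 1
    have hτ' : u0 * v1 = u1 * v0 := by
      have : cross a z b = u0 * v1 - u1 * v0 := by simp only [cross, u0, u1, v0, v1]; ring
      linarith
    set D := u0 * v0 + u1 * v1
    set U := u0 ^ 2 + u1 ^ 2
    set V := v0 ^ 2 + v1 ^ 2
    have hv0 : U * v0 = D * u0 := by simp only [U, D]; linear_combination -u1 * hτ'
    have hv1 : U * v1 = D * u1 := by simp only [U, D]; linear_combination u0 * hτ'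
    have hDD : D ^ 2 = U * V := by
      simp only [U, D, V]; linear_combination - (u0 * v1 - u1 * v0) * hτ'
    have hD : 0 < D := by
      by_contra! hD
      have hD : D < 0 := lt_of_le_of_ne hD (by
        rintro h0; rw [h0] at hDD; nlinarith [mul_pos hn hn'])
      have hUD : 0 < U - D := by linarith
      -- If the path folded back, then `v = (D / U) u` with `D < 0`. This `c` solves `z + c v = a +
      -- c u`, which gives a common point of both edges other than `z`.
      set c := U / (U - D) with hc
      have hc0 : 0 < c := by positivity
      have hc1 : c ≤ 1 := by rw [hc, div_le_one hUD]; linarith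
      set y : Plane := !₂[z 0 + c * v0, z 1 + c * v1] with hy
      have h2 : y ∈ affineSegment ℝ z b := mem_affineSegment_iff.2 ⟨c, ⟨hc0.le, hc1⟩,
        by simp [hy, v0], by simp [hy, v1]⟩
      have hcU : c * (U - D) = U := by rw [hc]; field_simp
      have h1 : y ∈ affineSegment ℝ a z := by
        refine mem_affineSegment_iff.2 ⟨c, ⟨hc0.le, hc1⟩, ?_, ?_⟩
        · have : U * (u0 + c * v0) = U * (c * u0) := by linear_combination c * hv0 - u0 * hcU
          have := mul_left_cancel₀ hn.ne' this
          simp only [hy, PiLp.toLp_apply, Matrix.cons_val_zero]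
          change z 0 + c * v0 = a 0 + c * u0
          simp only [u0] at this ⊢; linarith
        · have : U * (u1 + c * v1) = U * (c * u1) := by linear_combination c * hv1 - u1 * hcU
          have := mul_left_cancel₀ hn.ne' this
          simp only [hy, PiLp.toLp_apply, Matrix.cons_val_one]
          change z 1 + c * v1 = a 1 + c * u1
          simp only [u1] at this ⊢; linarith
      have h3 := h ⟨h1, h2⟩
      have e0 : c * v0 = 0 := by have := congrArg (fun x : Plane => x 0) h3; simpa [hy] using this
      have e1 : c * v1 = 0 := by have := congrArg (fun x : Plane => x 1) h3; simpa [hy] using this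
      have e0 := (mul_eq_zero.1 e0).resolve_left hc0.ne'
      have e1 := (mul_eq_zero.1 e1).resolve_left hc0.ne'
      exact hzb (ext_coord (by simp only [v0] at e0; linarith) (by simp only [v1] at e1; linarith))
    have hUD : 0 < U + D := by linarith
    set t := U / (U + D) with ht
    have htU : t * (U + D) = U := by rw [ht]; field_simp
    have ht0 : 0 < t := by positivity
    have ht1 : t < 1 := by rw [ht, div_lt_one hUD]; linarith
    have f0 : u0 = t * (u0 + v0) := by
      have : U * u0 = U * (t * (u0 + v0)) := by linear_combination -t * hv0 - u0 * htU
      exact mul_left_cancel₀ hn.ne' this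
    have f1 : u1 = t * (u1 + v1) := by
      have : U * u1 = U * (t * (u1 + v1)) := by linear_combination -t * hv1 - u1 * htU
      exact mul_left_cancel₀ hn.ne' this
    have g0 : z 0 = a 0 + t * (b 0 - a 0) := by simp only [u0, v0] at f0; linarith
    have g1 : z 1 = a 1 + t * (b 1 - a 1) := by simp only [u1, v1] at f1; linarith
    have hab : a ≠ b := by
      rintro rfl
      exact haz (ext_coord (by rw [g0]; ring) (by rw [g1]; ring))
    rw [affineSegment_union_of_mem ht0 ht1 g0 g1]
    exact isTwoSided_segment hab ht0 ht1 g0 g1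
  · exact isTwoSided_corner_of_pos hτ

end Plane

/-! ### The winding number of a polygon -/

namespace Polygon

open Plane

variable {n : ℕ}

/-- The winding number of the polygon about a point, as a signed count of ray crossings. -/
def winding (p : Polygon Plane n) (x : Plane) : ℤ :=
  ∑ i, crossing (p i) (p (finRotate n i)) x

lemma sum_vertexTerm (p : Polygon Plane n) (x y : Plane) :
    ∑ i, vertexTerm (p i) x y = ∑ i, vertexTerm (p (finRotate n i)) x y :=
  (Equiv.sum_comp (finRotate n) fun i => vertexTerm (p i) x y).symm

/-- Each vertex is the start of one edge and the end of another, so the corrections cancel; the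
winding number inherits the local behaviour of the corrected crossing numbers. -/
lemma winding_eq_sum (p : Polygon Plane n) (x y : Plane) :
    p.winding y = ∑ i, (crossing (p i) (p (finRotate n i)) y + vertexTerm (p i) x y -
      vertexTerm (p (finRotate n i)) x y) := by
  rw [Finset.sum_sub_distrib, Finset.sum_add_distrib, sum_vertexTerm, add_sub_cancel_right,
    winding]

lemma notMem_boundary {p : Polygon Plane n} {x : Plane} :
    x ∉ p.boundary ℝ ↔ ∀ i, x ∉ p.edgeSet ℝ i := by
  simp [boundary]

lemma winding_locally_const {p : Polygon Plane n} {x : Plane} (hx : x ∉ p.boundary ℝ) :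
    ∀ᶠ y in 𝓝 x, p.winding y = p.winding x := by
  choose k hk using fun i => crossing_locally_const (notMem_boundary.1 hx i)
  have : ∀ᶠ y in 𝓝 x, p.winding y = ∑ i, k i := by
    filter_upwards [eventually_all.2 hk] with y hy
    rw [p.winding_eq_sum x y]
    exact Finset.sum_congr rfl fun i _ => hy i
  filter_upwards [this] with y hy
  rw [hy, this.self_of_nhds]

lemma winding_const_of_isPreconnected {p : Polygon Plane n} {s : Set Plane}
    (hs : IsPreconnected s) (hsub : s ⊆ (p.boundary ℝ)ᶜ) {x y : Plane} (hx : x ∈ s) (hy : y ∈ s) :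
    p.winding x = p.winding y := by
  refine hs.constant (f := p.winding) (fun z hz => ?_) hx hy
  refine ContinuousAt.continuousWithinAt ?_
  exact tendsto_const_nhds.congr' ((winding_locally_const (hsub hz)).mono fun y hy => hy.symm)

/-- Outside a box around the vertices the ray either misses all edges or, below the box, meets every
edge above it, and the signs cancel. -/
lemma isBounded_winding_ne_zero (p : Polygon Plane n) :
    Bornology.IsBounded {x | p.winding x ≠ 0} := by
  obtain ⟨M, hM⟩ : ∃ M : ℝ, ∀ i (j : Fin 2), |p i j| ≤ M := by
    have h : Set.Finite (Set.range fun q : Fin n × Fin 2 => |p q.1 q.2|) := Set.finite_range _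
    obtain ⟨M, hM⟩ := h.bddAbove
    exact ⟨M, fun i j => hM ⟨(i, j), rfl⟩⟩
  rw [isBounded_iff_forall_norm_le]
  refine ⟨2 * M, fun x hx => ?_⟩
  have key : |x 0| ≤ M ∧ |x 1| ≤ M := by
    by_contra hcon
    apply hx
    have hb : ∀ i j, -M ≤ p i j ∧ p i j ≤ M := fun i j => abs_le.1 (hM i j)
    have hcases : x 0 < -M ∨ M < x 0 ∨ x 1 < -M ∨ M < x 1 := by
      rw [abs_le, abs_le] at hcon; grind
    rcases hcases with h | h | h | h
    · refine Finset.sum_eq_zero fun i _ => ?_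
      have := hb i 0; have := hb (finRotate n i) 0
      simp only [crossing, below, Set.mem_ofPred_eq]
      grind
    · refine Finset.sum_eq_zero fun i _ => ?_
      have := hb i 0; have := hb (finRotate n i) 0
      simp only [crossing, below, Set.mem_ofPred_eq]
      grind
    -- Below the box the crossing number of an edge is the increment along it of the indicator of
    -- the half-plane to the left of `x`, so the sum telescopes.
    · let g : Plane → ℤ := fun a => if a 0 ≤ x 0 then 1 else 0
      have hg : ∀ i, crossing (p i) (p (finRotate n i)) x = g (p (finRotate n i)) - g (p i) := by
        intro i
        have h1 := hb i 1
        have h2 := hb (finRotate n i) 1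
        have key : ∀ a b : Plane, x 1 < a 1 → x 1 < b 1 → a 0 ≤ x 0 → x 0 < b 0 →
            cross a b x < 0 := by
          intro a b ha hb' h1 h2
          have e : cross a b x * 1 = (b 0 - x 0) * (x 1 - a 1) + (x 0 - a 0) * (x 1 - b 1) := by
            simp only [cross]; ring
          nlinarith [mul_pos (sub_pos.2 h2) (sub_pos.2 ha),
            mul_nonneg (sub_nonneg.2 h1) (sub_pos.2 hb').le]
        have k1 := key (p i) (p (finRotate n i)) (by linarith) (by linarith)
        have k2 := key (p (finRotate n i)) (p i) (by linarith) (by linarith)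
        simp only [crossing, below, Set.mem_ofPred_eq, g]
        grind
      rw [winding, Finset.sum_congr rfl fun i _ => hg i, Finset.sum_sub_distrib,
        Equiv.sum_comp (finRotate n) fun i => g (p i), sub_self]
    · refine Finset.sum_eq_zero fun i _ => ?_
      have h1 := hb i 1
      have h2 := hb (finRotate n i) 1
      have key : ∀ a b : Plane, a 1 < x 1 → b 1 < x 1 → a 0 ≤ x 0 → x 0 < b 0 →
          0 < cross a b x := by
        intro a b ha hb' h1 h2
        have e : cross a b x * 1 = (b 0 - x 0) * (x 1 - a 1) + (x 0 - a 0) * (x 1 - b 1) := by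
          simp only [cross]; ring
        nlinarith [mul_pos (sub_pos.2 h2) (sub_pos.2 ha),
          mul_nonneg (sub_nonneg.2 h1) (sub_pos.2 hb').le]
      have k1 := key (p i) (p (finRotate n i)) (by linarith) (by linarith)
      have k2 := key (p (finRotate n i)) (p i) (by linarith) (by linarith)
      simp only [crossing, below, Set.mem_ofPred_eq]
      grind
  have hM0 : 0 ≤ M := (abs_nonneg _).trans key.1
  rw [EuclideanSpace.norm_eq, Real.sqrt_le_left (by linarith)]
  simp only [Fin.sum_univ_two, Real.norm_eq_abs]
  nlinarith [key.1, key.2, abs_nonneg (x 0), abs_nonneg (x 1)]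

lemma finRotate_ne (hn : 3 ≤ n) (i : Fin n) :
    finRotate n i ≠ i ∧ finRotate n (finRotate n i) ≠ i := by
  obtain ⟨m, rfl⟩ : ∃ m, n = m + 3 := ⟨n - 3, by omega⟩
  simp only [finRotate_apply]
  constructor
  · simp
  · rw [add_assoc, Ne, add_eq_left, Fin.ext_iff, Fin.val_add]
    simp only [Fin.coe_ofNat_eq_mod, Nat.zero_mod]
    rw [Nat.mod_eq_of_lt (by omega : 1 < m + 3), Nat.mod_eq_of_lt (by omega)]
    omega

lemma isClosed_boundary (p : Polygon Plane n) : IsClosed (p.boundary ℝ) :=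
  isClosed_iUnion_of_finite fun _ => isClosed_affineSegment _ _

lemma isCompact_boundary (p : Polygon Plane n) : IsCompact (p.boundary ℝ) :=
  isCompact_iUnion fun _ => isCompact_Icc.image AffineMap.lineMap_continuous

lemma eventually_notMem_edgeSet {p : Polygon Plane n} {Q : Fin n → Prop} {z : Plane}
    (h : ∀ j, Q j → z ∉ p.edgeSet ℝ j) : ∀ᶠ y in 𝓝 z, ∀ j, Q j → y ∉ p.edgeSet ℝ j := by
  refine eventually_all.2 fun j => ?_
  by_cases hj : Q j
  · filter_upwards [(isClosed_affineSegment _ _).isOpen_compl.mem_nhds (h j hj)] with y hy _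
    exact hy
  · exact Eventually.of_forall fun y h' => absurd h' hj

variable {p : Polygon Plane n}

lemma IsSimple.vertex_ne (hp : p.IsSimple) (hn : 3 ≤ n) (i : Fin n) : p i ≠ p (finRotate n i) :=
  fun h => (finRotate_ne hn i).1 (hp.1 h).symm

/-- `z` lies in the relative interior of the `i`-th edge. -/
def IsInnerPoint (p : Polygon Plane n) (i : Fin n) (z : Plane) : Prop :=
  ∃ t : ℝ, 0 < t ∧ t < 1 ∧ z 0 = p i 0 + t * (p (finRotate n i) 0 - p i 0) ∧
    z 1 = p i 1 + t * (p (finRotate n i) 1 - p i 1)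

lemma IsInnerPoint.mem {i : Fin n} {z : Plane} (h : p.IsInnerPoint i z) : z ∈ p.edgeSet ℝ i := by
  obtain ⟨t, ht, ht1, h0, h1⟩ := h
  exact mem_affineSegment_iff.2 ⟨t, ⟨ht.le, ht1.le⟩, h0, h1⟩

lemma IsInnerPoint.notMem (hp : p.IsSimple) (hn : 3 ≤ n) {i j : Fin n} {z : Plane}
    (h : p.IsInnerPoint i z) (hij : j ≠ i) : z ∉ p.edgeSet ℝ j := by
  intro hj
  have hne := normSq_pos (hp.vertex_ne hn i)
  have hz := (hp.2 i j hij.symm ⟨h.mem, hj⟩).1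
  obtain ⟨t, ht, ht1, h0, h1⟩ := h
  rcases hz with rfl | hz
  · have e0 : p (finRotate n i) 0 - p i 0 = 0 := by
      have : t * (p (finRotate n i) 0 - p i 0) = 0 := by linarith
      exact (mul_eq_zero.1 this).resolve_left ht.ne'
    have e1 : p (finRotate n i) 1 - p i 1 = 0 := by
      have : t * (p (finRotate n i) 1 - p i 1) = 0 := by linarith
      exact (mul_eq_zero.1 this).resolve_left ht.ne'
    rw [e0, e1] at hne; simp at hne
  · rw [Set.mem_singleton_iff] at hz
    subst hz
    have e0 : p (finRotate n i) 0 - p i 0 = 0 := by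
      have : (1 - t) * (p (finRotate n i) 0 - p i 0) = 0 := by linarith
      exact (mul_eq_zero.1 this).resolve_left (by linarith)
    have e1 : p (finRotate n i) 1 - p i 1 = 0 := by
      have : (1 - t) * (p (finRotate n i) 1 - p i 1) = 0 := by linarith
      exact (mul_eq_zero.1 this).resolve_left (by linarith)
    rw [e0, e1] at hne; simp at hne

/-- Next to an inner point of an edge the winding number takes two consecutive values. -/
lemma IsInnerPoint.winding (hp : p.IsSimple) (hn : 3 ≤ n) {i : Fin n} {z : Plane}
    (h : p.IsInnerPoint i z) : ∃ k : ℤ, ∀ U ∈ 𝓝 z,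
      (∃ y ∈ U, y ∉ p.boundary ℝ ∧ p.winding y = k) ∧
      (∃ y ∈ U, y ∉ p.boundary ℝ ∧ p.winding y = k + 1) := by
  have hne := hp.vertex_ne hn i
  have hoff : ∀ j, j ≠ i → z ∉ p.edgeSet ℝ j := fun j hj => h.notMem hp hn hj
  have hmem := h.mem
  obtain ⟨t, ht, ht1, h0, h1⟩ := h
  obtain ⟨k, hk⟩ := crossing_jump hne ht ht1 h0 h1
  choose! l hl using fun j (hj : j ≠ i) => crossing_locally_const (hoff j hj)
  have hl' : ∀ᶠ y in 𝓝 z, ∀ j, j ≠ i → crossing (p j) (p (finRotate n j)) y +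
      vertexTerm (p j) z y - vertexTerm (p (finRotate n j)) z y = l j := by
    refine eventually_all.2 fun j => ?_
    by_cases hj : j = i
    · exact Eventually.of_forall fun y h' => absurd hj h'
    · exact (hl j hj).mono fun y hy _ => hy
  set m := k + ∑ j ∈ Finset.univ.erase i, l j with hm
  have hw : ∀ᶠ y in 𝓝 z, cross (p i) (p (finRotate n i)) y ≠ 0 → y ∉ p.boundary ℝ ∧
      p.winding y = m + if 0 < cross (p i) (p (finRotate n i)) y then 1 else 0 := by
    filter_upwards [hk, hl', eventually_notMem_edgeSet hoff] with y h1 h2 h3 h4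
    refine ⟨notMem_boundary.2 fun j => ?_, ?_⟩
    · by_cases hj : j = i
      · subst hj
        exact fun h' => h4 (cross_eq_zero_of_mem h')
      · exact h3 j hj
    · rw [p.winding_eq_sum z y, ← Finset.add_sum_erase _ _ (Finset.mem_univ i), h1 h4,
        Finset.sum_congr rfl fun j hj => h2 j (Finset.ne_of_mem_erase hj), hm]
      ring
  have hz0 := cross_eq_zero_of_mem hmem
  refine ⟨m, fun U hU => ⟨?_, ?_⟩⟩
  · obtain ⟨y, hy, hy'⟩ := mem_closure_iff_nhds.1 (mem_closure_cross_neg hne hz0) _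
      (inter_mem hU hw)
    obtain ⟨h5, h6⟩ := hy.2 (ne_of_lt hy')
    exact ⟨y, hy.1, h5, by rw [h6, if_neg (not_lt.2 (le_of_lt hy')), add_zero]⟩
  · obtain ⟨y, hy, hy'⟩ := mem_closure_iff_nhds.1 (mem_closure_cross_pos hne hz0) _
      (inter_mem hU hw)
    obtain ⟨h5, h6⟩ := hy.2 (ne_of_gt hy')
    exact ⟨y, hy.1, h5, by rw [h6, if_pos (show 0 < cross _ _ y from hy')]⟩

lemma exists_isInnerPoint_or_eq_vertex {z : Plane} (hz : z ∈ p.boundary ℝ) :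
    ∃ i, p.IsInnerPoint i z ∨ z = p (finRotate n i) := by
  obtain ⟨i, hi⟩ := Set.mem_iUnion.1 hz
  obtain ⟨t, ht, h0, h1⟩ := mem_affineSegment_iff.1 hi
  rcases ht.1.eq_or_lt with rfl | ht0
  · refine ⟨(finRotate n).symm i, Or.inr ?_⟩
    rw [Equiv.apply_symm_apply]
    exact ext_coord (by rw [h0]; ring) (by rw [h1]; ring)
  · rcases ht.2.eq_or_lt with rfl | ht1
    · exact ⟨i, Or.inr (ext_coord (by rw [h0]; ring) (by rw [h1]; ring))⟩
    · exact ⟨i, Or.inl ⟨t, ht0, ht1, h0, h1⟩⟩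

/-- The jump of the winding number is known at inner points only. Since they are dense in the
boundary, it can be transferred to vertices. -/
lemma exists_isInnerPoint_mem {z : Plane} (hz : z ∈ p.boundary ℝ) {U : Set Plane} (hU : U ∈ 𝓝 z) :
    ∃ y ∈ U, ∃ i, p.IsInnerPoint i y := by
  obtain ⟨i, h | rfl⟩ := exists_isInnerPoint_or_eq_vertex hz
  · exact ⟨z, mem_of_mem_nhds hU, i, h⟩
  · set q : ℝ → Plane := fun δ => p (finRotate n i) + δ • (p i - p (finRotate n i))
    have hq : Continuous q := by fun_prop
    have h2 := hq.tendsto 0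
    simp only [q, zero_smul, add_zero] at h2
    have h3 := (h2.mono_left (nhdsWithin_le_nhds (s := Set.Ioi 0))).eventually hU
    obtain ⟨δ, hδ, hδ'⟩ := (h3.and (Ioo_mem_nhdsGT (zero_lt_one (α := ℝ)))).exists
    refine ⟨_, hδ, i, 1 - δ, by linarith [hδ'.2], by linarith [hδ'.1], ?_, ?_⟩ <;>
    · simp; ring

lemma isTwoSided_boundary (hp : p.IsSimple) (hn : 3 ≤ n) {z : Plane} (hz : z ∈ p.boundary ℝ) :
    IsTwoSided (p.boundary ℝ) z := by
  obtain ⟨i, h | rfl⟩ := exists_isInnerPoint_or_eq_vertex hz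
  · have hoff : ∀ j, j ≠ i → z ∉ p.edgeSet ℝ j := fun j hj => h.notMem hp hn hj
    obtain ⟨t, ht, ht1, h0, h1⟩ := h
    refine (isTwoSided_segment (hp.vertex_ne hn i) ht ht1 h0 h1).congr ?_
    filter_upwards [eventually_notMem_edgeSet hoff] with y hy
    constructor
    · exact fun h' => Set.mem_iUnion.2 ⟨i, h'⟩
    · intro h'
      obtain ⟨j, hj⟩ := Set.mem_iUnion.1 h'
      obtain rfl : j = i := by by_contra hne; exact hy j hne hj
      exact hj
  · set j := finRotate n i with hj
    have hji : i ≠ j := (finRotate_ne hn i).1.symm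
    have hoff : ∀ k, k ≠ i ∧ k ≠ j → p j ∉ p.edgeSet ℝ k := by
      rintro k ⟨hki, hkj⟩ hk
      have hpj : p j ∈ p.edgeSet ℝ j := left_mem_affineSegment ℝ _ _
      rcases (hp.2 k j hkj ⟨hk, hpj⟩).1 with h1 | h1
      · exact hkj (hp.1 h1).symm
      · exact hki ((finRotate n).injective (hp.1 h1)).symm
    refine (isTwoSided_corner (a := p i) (z := p j) (b := p (finRotate n j))
      (hp.vertex_ne hn i) (hp.vertex_ne hn j) ?_).congr ?_
    · intro y hy
      have := hp.2 i j hji hy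
      rcases this with ⟨h1 | h1, h2 | h2⟩
      · exact h2
      · exact absurd (hp.1 (h1.symm.trans h2)).symm (finRotate_ne hn i).2
      · exact h2
      · exact h1
    · filter_upwards [eventually_notMem_edgeSet hoff] with y hy
      constructor
      · rintro (h' | h')
        · exact Set.mem_iUnion.2 ⟨i, h'⟩
        · exact Set.mem_iUnion.2 ⟨j, h'⟩
      · intro h'
        obtain ⟨k, hk⟩ := Set.mem_iUnion.1 h'
        by_cases hki : k = i
        · subst hki; exact Or.inl hk
        · by_cases hkj : k = j
          · subst hkj; exact Or.inr hk
          · exact absurd hk (hy k ⟨hki, hkj⟩)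

end Polygon

/-! ### The Jordan curve theorem for simple polygons -/

namespace Polygon

open Plane

variable {n : ℕ} {p : Polygon Plane n}

lemma isPreconnected_boundary (p : Polygon Plane n) : IsPreconnected (p.boundary ℝ) := by
  rcases n.eq_zero_or_pos with rfl | hn
  · simp [boundary, isPreconnected_empty]
  obtain ⟨m, rfl⟩ : ∃ m, n = m + 1 := ⟨n - 1, by omega⟩
  have hseg : ∀ i, IsPreconnected (p.edgeSet ℝ i) := fun i =>
    isPreconnected_Icc.image _ AffineMap.lineMap_continuous.continuousOn
  have key : ∀ i : Fin (m + 1), Relation.ReflTransGen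
      (fun i j => (p.edgeSet ℝ i ∩ p.edgeSet ℝ j).Nonempty) 0 i := by
    intro i
    induction i using Fin.induction with
    | zero => exact Relation.ReflTransGen.refl
    | succ i ih =>
      refine ih.tail ⟨p i.succ, ?_, left_mem_affineSegment ℝ _ _⟩
      have : finRotate (m + 1) i.castSucc = i.succ := by
        rw [finRotate_apply]; exact Fin.coeSucc_eq_succ
      rw [edgeSet, this]
      exact right_mem_affineSegment ℝ _ _
  refine IsPreconnected.iUnion_of_reflTransGen hseg fun i j => ?_
  refine Relation.ReflTransGen.trans ?_ (key j)
  have : Std.Symm fun i j => (p.edgeSet ℝ i ∩ p.edgeSet ℝ j).Nonempty :=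
    ⟨fun a b h => by rwa [Set.inter_comm]⟩
  exact Relation.ReflTransGen.stdSymm.symm _ _ (key i)

/-- The component of the complement of the boundary that contains `x`. -/
def component (p : Polygon Plane n) (x : Plane) : Set Plane :=
  connectedComponentIn (p.boundary ℝ)ᶜ x

lemma component_eq_of_isPreconnected {s : Set Plane}
    (hs : IsPreconnected s) (hsub : s ⊆ (p.boundary ℝ)ᶜ) {x y : Plane} (hx : x ∈ s) (hy : y ∈ s) :
    p.component x = p.component y :=
  connectedComponentIn_eq (hs.subset_connectedComponentIn hx hsub hy)

/-- Near `z` the points off the boundary lie in the component `C` with winding number `k + 1` or in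
the component `D` with winding number `k`. -/
def IsLocalPattern (p : Polygon Plane n) (k : ℤ) (C D : Set Plane) (z : Plane) : Prop :=
  ∀ᶠ y in 𝓝 z, y ∉ p.boundary ℝ →
    (p.winding y = k + 1 ∧ p.component y = C) ∨ (p.winding y = k ∧ p.component y = D)

/-- Each local side is connected, so it has one winding number and one component. The second clause,
that both labels also occur arbitrarily close to all nearby boundary points, makes the labels
comparable from one boundary point to the next. -/
lemma exists_isLocalPattern (hp : p.IsSimple) (hn : 3 ≤ n) {z : Plane}
    (hz : z ∈ p.boundary ℝ) : ∃ k C D, p.IsLocalPattern k C D z ∧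
      ∀ᶠ z' in 𝓝 z, z' ∈ p.boundary ℝ → ∀ U ∈ 𝓝 z',
        (∃ y ∈ U, y ∉ p.boundary ℝ ∧ p.winding y = k + 1 ∧ p.component y = C) ∧
        (∃ y ∈ U, y ∉ p.boundary ℝ ∧ p.winding y = k ∧ p.component y = D) := by
  obtain ⟨r, ⟨A, B, hA, hB, hu, hc⟩, hr⟩ :=
    ((isTwoSided_boundary hp hn hz).and eventually_mem_nhdsWithin).exists
  have hr : 0 < r := hr
  have hball : Metric.ball z r ∈ 𝓝 z := Metric.ball_mem_nhds z hr
  have hAs : A ⊆ (p.boundary ℝ)ᶜ := fun y hy => (hu.subset (Or.inl hy)).2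
  have hBs : B ⊆ (p.boundary ℝ)ᶜ := fun y hy => (hu.subset (Or.inr hy)).2
  have hzr : z ∈ Metric.ball z r := Metric.mem_ball_self hr
  obtain ⟨a, ha⟩ := closure_nonempty_iff.1 ⟨z, (hc z ⟨hzr, hz⟩).1⟩
  obtain ⟨b, hb⟩ := closure_nonempty_iff.1 ⟨z, (hc z ⟨hzr, hz⟩).2⟩
  have hAw : ∀ y ∈ A, p.winding y = p.winding a ∧ p.component y = p.component a := fun y hy =>
    ⟨winding_const_of_isPreconnected hA hAs hy ha, component_eq_of_isPreconnected hA hAs hy ha⟩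
  have hBw : ∀ y ∈ B, p.winding y = p.winding b ∧ p.component y = p.component b := fun y hy =>
    ⟨winding_const_of_isPreconnected hB hBs hy hb, component_eq_of_isPreconnected hB hBs hy hb⟩
  have hcov : ∀ᶠ y in 𝓝 z, y ∉ p.boundary ℝ → y ∈ A ∨ y ∈ B := by
    filter_upwards [hball] with y hy hy'
    exact hu.superset ⟨hy, hy'⟩
  have hacc : ∀ᶠ z' in 𝓝 z, z' ∈ p.boundary ℝ → ∀ U ∈ 𝓝 z',
      (∃ y ∈ U, y ∈ A) ∧ (∃ y ∈ U, y ∈ B) := by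
    filter_upwards [hball] with z' hz' hz'' U hU
    obtain ⟨h1, h2⟩ := hc z' ⟨hz', hz''⟩
    exact ⟨mem_closure_iff_nhds.1 h1 U hU, mem_closure_iff_nhds.1 h2 U hU⟩
  -- Even if `z` is a vertex, an inner point in the same disc shows that the winding numbers of the
  -- two sides are consecutive.
  obtain ⟨z1, hz1, i, hi⟩ := exists_isInnerPoint_mem hz hball
  obtain ⟨k, hk⟩ := hi.winding hp hn
  obtain ⟨⟨y, hy, hyb, hyw⟩, ⟨y', hy', hyb', hyw'⟩⟩ := hk _ (Metric.isOpen_ball.mem_nhds hz1)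
  have hyAB : y ∈ A ∪ B := hu.superset ⟨hy, hyb⟩
  have hyAB' : y' ∈ A ∪ B := hu.superset ⟨hy', hyb'⟩
  have hcases : (p.winding a = k + 1 ∧ p.winding b = k) ∨
      (p.winding a = k ∧ p.winding b = k + 1) := by
    rcases hyAB with h | h <;> rcases hyAB' with h' | h'
    · have := (hAw _ h).1; have := (hAw _ h').1; omega
    · have := (hAw _ h).1; have := (hBw _ h').1; omega
    · have := (hBw _ h).1; have := (hAw _ h').1; omega
    · have := (hBw _ h).1; have := (hBw _ h').1; omega
  rcases hcases with ⟨h1, h2⟩ | ⟨h1, h2⟩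
  · refine ⟨k, p.component a, p.component b, ?_, ?_⟩
    · filter_upwards [hcov] with y hy hyb
      exact (hy hyb).imp (fun h => h1 ▸ hAw y h) (fun h => h2 ▸ hBw y h)
    · filter_upwards [hacc] with z' h hz' U hU
      obtain ⟨⟨y, hy, hyA⟩, ⟨y', hy', hyB⟩⟩ := h hz' U hU
      exact ⟨⟨y, hy, hAs hyA, h1 ▸ hAw y hyA⟩, ⟨y', hy', hBs hyB, h2 ▸ hBw y' hyB⟩⟩
  · refine ⟨k, p.component b, p.component a, ?_, ?_⟩
    · filter_upwards [hcov] with y hy hyb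
      exact (hy hyb).symm.imp (fun h => h2 ▸ hBw y h) (fun h => h1 ▸ hAw y h)
    · filter_upwards [hacc] with z' h hz' U hU
      obtain ⟨⟨y, hy, hyA⟩, ⟨y', hy', hyB⟩⟩ := h hz' U hU
      exact ⟨⟨y', hy', hBs hyB, h2 ▸ hBw y' hyB⟩, ⟨y, hy, hAs hyA, h1 ▸ hAw y hyA⟩⟩

/-- The same two components lie on the two sides of the boundary everywhere. -/
lemma exists_isLocalPattern_forall (hp : p.IsSimple) (hn : 3 ≤ n) :
    ∃ k C D, ∀ z ∈ p.boundary ℝ, p.IsLocalPattern k C D z := by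
  by_cases hne : (p.boundary ℝ).Nonempty
  swap
  · exact ⟨0, ∅, ∅, fun z hz => absurd ⟨z, hz⟩ hne⟩
  obtain ⟨z0, hz0⟩ := hne
  obtain ⟨k, C, D, h0, -⟩ := exists_isLocalPattern hp hn hz0
  refine ⟨k, C, D, fun z hz => ?_⟩
  by_contra hcon
  -- Holding the fixed pattern and failing it on a whole neighbourhood in the boundary are open
  -- conditions that cover the connected boundary, so the pattern of `z0` spreads everywhere.
  have hU : IsOpen {z | p.IsLocalPattern k C D z} :=
    isOpen_iff_mem_nhds.2 fun z hz => eventually_eventually_nhds.2 hz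
  have hV : IsOpen {z | ∀ᶠ z' in 𝓝 z, z' ∈ p.boundary ℝ → ¬ p.IsLocalPattern k C D z'} :=
    isOpen_iff_mem_nhds.2 fun z hz => eventually_eventually_nhds.2 hz
  have hcov : ∀ z ∈ p.boundary ℝ, p.IsLocalPattern k C D z ∨
      ∀ᶠ z' in 𝓝 z, z' ∈ p.boundary ℝ → ¬ p.IsLocalPattern k C D z' := by
    intro z hz
    obtain ⟨k', C', D', h, h'⟩ := exists_isLocalPattern hp hn hz
    by_cases hq : ∀ᶠ z' in 𝓝 z, z' ∈ p.boundary ℝ → ¬ p.IsLocalPattern k C D z'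
    · exact Or.inr hq
    left
    obtain ⟨z', hz', hz''⟩ := (Filter.not_eventually.1 hq).and_eventually h' |>.exists
    push Not at hz'
    obtain ⟨hzb, hpat⟩ := hz'
    obtain ⟨⟨y, hy, hyb, hyw, hyC⟩, ⟨y', hy', hyb', hyw', hyC'⟩⟩ := hz'' hzb _ hpat
    have a1 := hy hyb
    have a2 := hy' hyb'
    obtain ⟨rfl, rfl, rfl⟩ : k' = k ∧ C' = C ∧ D' = D := by
      have hk : k' = k := by omega
      subst hk
      refine ⟨rfl, ?_, ?_⟩
      · rcases a1 with a1 | a1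
        · rw [← hyC, a1.2]
        · omega
      · rcases a2 with a2 | a2
        · omega
        · rw [← hyC', a2.2]
    exact h
  obtain ⟨y, hy, hyU, hyV⟩ := isPreconnected_boundary p _ _ hU hV (fun z hz => hcov z hz)
    ⟨z0, hz0, h0⟩ ⟨z, hz, (hcov z hz).resolve_left hcon⟩
  exact hyV.self_of_nhds hy hyU

/-- The Jordan curve theorem for simple polygons: off the boundary the winding number is `0` or a
fixed sign `s`, and it is `s` exactly on the bounded components. -/
theorem exists_winding_sign (hp : p.IsSimple) (hn : 3 ≤ n) :
    ∃ s : ℤ, (s = 1 ∨ s = -1) ∧ ∀ x ∉ p.boundary ℝ,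
      (p.winding x = 0 ∨ p.winding x = s) ∧
      (Bornology.IsBounded (p.component x) ↔ p.winding x = s) := by
  obtain ⟨k, C, D, h⟩ := exists_isLocalPattern_forall hp hn
  have hΓ : (p.boundary ℝ).Nonempty :=
    ⟨p ⟨0, by omega⟩, Set.mem_iUnion.2 ⟨_, left_mem_affineSegment ℝ _ _⟩⟩
  have hself : ∀ x ∉ p.boundary ℝ, x ∈ p.component x := fun x hx => mem_connectedComponentIn hx
  have hsub : ∀ x, p.component x ⊆ (p.boundary ℝ)ᶜ := fun x => connectedComponentIn_subset _ _
  have hpre : ∀ x, IsPreconnected (p.component x) := fun x => isPreconnected_connectedComponentIn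
  have hlab : ∀ x ∉ p.boundary ℝ, (p.winding x = k + 1 ∧ p.component x = C) ∨
      (p.winding x = k ∧ p.component x = D) := by
    intro x hx
    have hopen : IsOpen (p.component x) :=
      (isClosed_boundary p).isOpen_compl.connectedComponentIn
    -- The plane is connected, so the component has a frontier point. Components are open and equal
    -- or disjoint, so this point lies on the polygon, and the pattern there labels the component.
    obtain ⟨z, hz⟩ : (frontier (p.component x)).Nonempty := by
      by_contra hf
      rw [Set.not_nonempty_iff_eq_empty, ← isClopen_iff_frontier_eq_empty] at hf
      rcases isClopen_iff.1 hf with h1 | h1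
      · exact (h1 ▸ hself x hx : x ∈ (∅ : Set Plane))
      · obtain ⟨z, hz⟩ := hΓ
        exact hsub x (h1 ▸ Set.mem_univ z) hz
    have hzΓ : z ∈ p.boundary ℝ := by
      by_contra hzΓ
      have hzo : p.component z ∈ 𝓝 z :=
        ((isClosed_boundary p).isOpen_compl.connectedComponentIn).mem_nhds (hself z hzΓ)
      obtain ⟨y, hy, hy'⟩ := mem_closure_iff_nhds.1 hz.1 _ hzo
      have e1 : p.component z = p.component y := connectedComponentIn_eq hy
      have e2 : p.component x = p.component y := connectedComponentIn_eq hy'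
      have : z ∈ p.component x := by rw [e2, ← e1]; exact hself z hzΓ
      exact hz.2 (hopen.interior_eq.symm ▸ this)
    obtain ⟨y, hy, hy'⟩ := mem_closure_iff_nhds.1 hz.1 _ (h z hzΓ)
    have e : p.component x = p.component y := connectedComponentIn_eq hy'
    rw [winding_const_of_isPreconnected (hpre x) (hsub x) (hself x hx) hy', e]
    exact hy (hsub x hy')
  have hfin : Bornology.IsBounded ({x | p.winding x ≠ 0} ∪ p.boundary ℝ) :=
    (isBounded_winding_ne_zero p).union (isCompact_boundary p).isBounded
  have hfar : ∀ s : Set Plane, Bornology.IsBounded s →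
      ∃ y ∉ s, y ∉ p.boundary ℝ ∧ p.winding y = 0 := by
    intro s hs
    obtain ⟨y, hy⟩ : ∃ y, y ∉ s ∪ ({x | p.winding x ≠ 0} ∪ p.boundary ℝ) := by
      by_contra! hall
      exact NoncompactSpace.noncompact_univ (X := Plane) |>.elim
        (Metric.isCompact_of_isClosed_isBounded isClosed_univ
          ((hs.union hfin).subset fun y _ => hall y))
    simp only [Set.mem_union, Set.mem_ofPred_eq, not_or, not_not] at hy
    exact ⟨y, hy.1, hy.2.2, hy.2.1⟩
  have hbdd : ∀ x ∉ p.boundary ℝ, (Bornology.IsBounded (p.component x) ↔ p.winding x ≠ 0) := by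
    intro x hx
    constructor
    · intro hb h0
      -- A label is determined by its winding number. A bounded component with winding number `0`
      -- would therefore contain the far point `y`, which was chosen outside it.
      obtain ⟨y, hy, hyΓ, hy0⟩ := hfar _ hb
      have e : p.component y = p.component x := by
        rcases hlab x hx with h1 | h1 <;> rcases hlab y hyΓ with h2 | h2
        · rw [h1.2, h2.2]
        · omega
        · omega
        · rw [h1.2, h2.2]
      exact hy (e ▸ hself y hyΓ)
    · intro h0
      refine (isBounded_winding_ne_zero p).subset fun y hy => ?_
      rw [Set.mem_ofPred_eq,
        ← winding_const_of_isPreconnected (hpre x) (hsub x) (hself x hx) hy]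
      exact h0
  obtain ⟨y, -, hyΓ, hy0⟩ := hfar ∅ Bornology.isBounded_empty
  rcases hlab y hyΓ with h1 | h1
  · refine ⟨-1, Or.inr rfl, fun x hx => ?_⟩
    rw [hbdd x hx]
    have := hlab x hx
    constructor <;> omega
  · refine ⟨1, Or.inl rfl, fun x hx => ?_⟩
    rw [hbdd x hx]
    have := hlab x hx
    constructor <;> omega

end Polygon

/-! ### Areas under edges and the shoelace formula -/

namespace Plane

lemma measurable_coord (i : Fin 2) : Measurable fun x : Plane => x i :=
  (continuous_coord i).measurable

lemma measurableSet_below (a b : Plane) : MeasurableSet (below a b) :=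
  (measurableSet_le measurable_const (measurable_coord 0)).inter
    ((measurableSet_lt (measurable_coord 0) measurable_const).inter
      (measurableSet_lt (continuous_cross a b).measurable measurable_const))

/-- The standard coordinates on the plane. -/
def coordEquiv : Plane ≃ᵐ ℝ × ℝ :=
  (MeasurableEquiv.toLp 2 (Fin 2 → ℝ)).symm.trans MeasurableEquiv.finTwoArrow

lemma measurePreserving_coordEquiv : MeasurePreserving coordEquiv volume volume :=
  (EuclideanSpace.volume_preserving_symm_measurableEquiv_toLp (Fin 2)).trans
    (volume_preserving_finTwoArrow ℝ)

lemma coordEquiv_apply (x : Plane) : coordEquiv x = (x 0, x 1) := rfl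

lemma volume_below_inter {a b : Plane} {m : ℝ} (ha : m ≤ a 1) (hb : m ≤ b 1) :
    volume (below a b ∩ {x | m < x 1}) =
      ENNReal.ofReal (max (b 0 - a 0) 0 * ((a 1 + b 1) / 2 - m)) := by
  rcases le_or_gt (b 0) (a 0) with hab | hab
  · have : below a b = ∅ := by
      ext x; simp only [below, Set.mem_ofPred_eq, Set.mem_empty_iff_false, iff_false]
      rintro ⟨h1, h2, -⟩; linarith
    rw [this, Set.empty_inter, measure_empty, max_eq_right (by linarith), zero_mul,
      ENNReal.ofReal_zero]
  have hd : 0 < b 0 - a 0 := by linarith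
  set k := (b 1 - a 1) / (b 0 - a 0) with hk
  have hkd : k * (b 0 - a 0) = b 1 - a 1 := by rw [hk]; field_simp
  set g : ℝ → ℝ := fun s => a 1 + k * (s - a 0) with hg
  have hset : below a b ∩ {x | m < x 1} =
      coordEquiv ⁻¹' regionBetween (fun _ => m) g (Set.Ico (a 0) (b 0)) := by
    ext x
    simp only [below, Set.mem_inter_iff, Set.mem_ofPred_eq, Set.mem_preimage, coordEquiv_apply,
      regionBetween, Set.mem_Ico, Set.mem_Ioo]
    have : cross a b x < 0 ↔ x 1 < g (x 0) := by
      have e : cross a b x = (b 0 - a 0) * (x 1 - g (x 0)) := by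
        simp only [cross, hg]; linear_combination (x 0 - a 0) * hkd
      rw [e, mul_neg_iff]
      constructor
      · rintro (h | h) <;> linarith
      · intro h; left; constructor <;> linarith
    rw [this]; tauto
  have hgc : Continuous g := by fun_prop
  rw [hset, measurePreserving_coordEquiv.measure_preimage_equiv, Measure.volume_eq_prod,
    volume_regionBetween_eq_integral (integrableOn_const (by simp))
      ((hgc.integrableOn_Icc).mono_set Set.Ico_subset_Icc_self) measurableSet_Ico,
    integral_Ico_eq_integral_Ioc, ← intervalIntegral.integral_of_le hab.le]
  · congr 1
    rw [intervalIntegral.integral_eq_sub_of_hasDerivAt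
      (f := fun s => (a 1 - m) * s + k * (s - a 0) ^ 2 / 2)]
    · rw [max_eq_left hd.le]
      linear_combination (b 0 - a 0) / 2 * hkd
    · intro s _
      have h1 := ((hasDerivAt_id s).const_mul (a 1 - m)).add
        (((((hasDerivAt_id s).sub_const (a 0)).pow 2).const_mul k).div_const 2)
      refine (h1.congr_deriv ?_ : HasDerivAt _ (g s - m) s)
      simp only [hg, id]; push_cast; ring
    · exact (hgc.sub continuous_const).intervalIntegrable _ _
  · intro s hs
    have h1 : 0 ≤ s - a 0 := by linarith [hs.1]
    have h2 : 0 ≤ b 0 - s := by linarith [hs.2]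
    have h3 : (b 0 - a 0) * (g s - m) = (b 0 - s) * (a 1 - m) + (s - a 0) * (b 1 - m) := by
      simp only [hg]; linear_combination (s - a 0) * hkd
    have h4 : 0 ≤ (b 0 - a 0) * (g s - m) := by
      rw [h3]; exact add_nonneg (mul_nonneg h2 (by linarith)) (mul_nonneg h1 (by linarith))
    have := nonneg_of_mul_nonneg_right h4 hd
    change m ≤ g s
    linarith

lemma volume_affineSegment (a b : Plane) : volume (affineSegment ℝ a b) = 0 := by
  have hne : line[ℝ, a, b] ≠ ⊤ := by
    intro h
    have h1 := collinear_iff_finrank_le_one.1 (collinear_pair ℝ a b)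
    rw [← direction_affineSpan, h, AffineSubspace.direction_top, finrank_top] at h1
    simp at h1
  refine measure_mono_null ?_ (Measure.addHaar_affineSubspace volume _ hne)
  rintro _ ⟨t, -, rfl⟩
  exact AffineMap.lineMap_mem_affineSpan_pair t a b

end Plane

namespace Polygon

open Plane

variable {n : ℕ} {p : Polygon Plane n}

/-- The signed area given by the shoelace formula. -/
def shoelace (p : Polygon Plane n) : ℝ :=
  ∑ i, (p i 0 * p (finRotate n i) 1 - p i 1 * p (finRotate n i) 0) / 2

/-- The integral is the signed area of the trapezoid between the edge and a horizontal line under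
the polygon. The cut at height `m` makes it finite. -/
lemma integral_crossing {a b : Plane} {m : ℝ} (ha : m ≤ a 1) (hb : m ≤ b 1) :
    IntegrableOn (fun x => (crossing a b x : ℝ)) {x | m < x 1} ∧
    ∫ x in {x | m < x 1}, (crossing a b x : ℝ) = (a 0 - b 0) * ((a 1 + b 1) / 2 - m) := by
  have hf : ∀ a b : Plane, m ≤ a 1 → m ≤ b 1 →
      IntegrableOn ((below a b).indicator fun _ => (1 : ℝ)) {x | m < x 1} ∧
      ∫ x in {x | m < x 1}, (below a b).indicator (fun _ => (1 : ℝ)) x =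
        max (b 0 - a 0) 0 * ((a 1 + b 1) / 2 - m) := by
    intro a b ha hb
    have hv := volume_below_inter ha hb
    constructor
    · rw [IntegrableOn, integrable_indicator_iff (measurableSet_below a b)]
      refine integrableOn_const ?_
      rw [Measure.restrict_apply (measurableSet_below a b), hv]
      exact ENNReal.ofReal_ne_top
    · rw [integral_indicator (measurableSet_below a b), setIntegral_const, smul_eq_mul, mul_one,
        Measure.real, Measure.restrict_apply (measurableSet_below a b), hv,
        ENNReal.toReal_ofReal]
      exact mul_nonneg (le_max_right _ _) (by linarith)
  have e : ∀ x, (crossing a b x : ℝ) = (below b a).indicator (fun _ => (1 : ℝ)) x -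
      (below a b).indicator (fun _ => (1 : ℝ)) x := by
    intro x
    by_cases h1 : x ∈ below b a <;> by_cases h2 : x ∈ below a b <;> simp [crossing, h1, h2]
  simp only [e]
  obtain ⟨i1, j1⟩ := hf a b ha hb
  obtain ⟨i2, j2⟩ := hf b a hb ha
  refine ⟨i2.sub i1, ?_⟩
  rw [integral_sub i2 i1, j1, j2]
  rcases le_total (a 0) (b 0) with h | h
  · rw [max_eq_right (by linarith), max_eq_left (by linarith)]; ring
  · rw [max_eq_left (by linarith), max_eq_right (by linarith)]; ring

lemma measurable_winding (p : Polygon Plane n) : Measurable p.winding := by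
  refine Finset.measurable_sum _ fun i _ => ?_
  exact (Measurable.ite (measurableSet_below _ _) measurable_const measurable_const).sub
    (Measurable.ite (measurableSet_below _ _) measurable_const measurable_const)

lemma volume_boundary (p : Polygon Plane n) : volume (p.boundary ℝ) = 0 :=
  measure_iUnion_null fun _ => volume_affineSegment _ _

/-- The shoelace formula for simple polygons. -/
theorem IsSimple.area_eq (hp : p.IsSimple) (hn : 3 ≤ n) :
    p.area = ENNReal.ofReal |p.shoelace| := by
  obtain ⟨s, hs, hx⟩ := exists_winding_sign hp hn
  have hs0 : s ≠ 0 := by omega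
  obtain ⟨m, hmv, hmw⟩ : ∃ m : ℝ, (∀ i, m ≤ p i 1) ∧ ∀ x, p.winding x ≠ 0 → m < x 1 := by
    obtain ⟨M, hM⟩ := isBounded_iff_forall_norm_le.1 (isBounded_winding_ne_zero p)
    obtain ⟨m, hm⟩ := (Set.finite_range fun i => p i 1).bddBelow
    refine ⟨min m (-M - 1), fun i => (min_le_left _ _).trans (hm ⟨i, rfl⟩), fun x hx => ?_⟩
    have h1 := hM x hx
    have h2 : |x 1| ≤ ‖x‖ := PiLp.norm_apply_le x 1
    have := neg_abs_le (x 1)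
    exact (min_le_right _ _).trans_lt (by linarith)
  set H : Set Plane := {x | m < x 1}
  have hreg : p.enclosedRegion = {x | x ∉ p.boundary ℝ ∧ p.winding x = s} := by
    ext x
    simp only [enclosedRegion, Set.mem_ofPred_eq]
    exact and_congr_right fun h => (hx x h).2
  have hmeas : MeasurableSet p.enclosedRegion := by
    rw [hreg]
    exact (isClosed_boundary p).measurableSet.compl.inter
      (measurable_winding p (measurableSet_singleton s))
  have hsubH : p.enclosedRegion ⊆ H := by
    rw [hreg]; exact fun x hx => hmw x (hx.2 ▸ hs0)
  have hbd : Bornology.IsBounded p.enclosedRegion := by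
    rw [hreg]; exact (isBounded_winding_ne_zero p).subset fun x hx => by
      rw [Set.mem_ofPred_eq, hx.2]; exact hs0
  have hfin : volume p.enclosedRegion ≠ ⊤ := hbd.measure_lt_top.ne
  have hint1 : ∫ x in H, (p.winding x : ℝ) = p.shoelace := by
    have hc := fun i => integral_crossing (hmv i) (hmv (finRotate n i))
    simp only [winding, Int.cast_sum]
    rw [integral_finsetSum _ fun i _ => (hc i).1, Finset.sum_congr rfl fun i _ => (hc i).2]
    -- The trapezoid of an edge differs from its shoelace term by an increment of `g`, which cancels
    -- around the polygon; the level `m` disappears with it.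
    set g : Fin n → ℝ := fun i => p i 0 * p i 1 / 2 - m * p i 0
    have e : ∀ i, (p i 0 - p (finRotate n i) 0) * ((p i 1 + p (finRotate n i) 1) / 2 - m) =
        (p i 0 * p (finRotate n i) 1 - p i 1 * p (finRotate n i) 0) / 2 +
          (g i - g (finRotate n i)) := fun i => by
      simp only [g]; ring
    rw [Finset.sum_congr rfl fun i _ => e i, Finset.sum_add_distrib, Finset.sum_sub_distrib,
      Equiv.sum_comp (finRotate n) g, sub_self, add_zero, shoelace]
  have hint2 : ∫ x in H, (p.winding x : ℝ) = s * volume.real p.enclosedRegion := by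
    have hae : ∀ᵐ x, (p.winding x : ℝ) = p.enclosedRegion.indicator (fun _ => (s : ℝ)) x := by
      have : ∀ᵐ x, x ∉ p.boundary ℝ := measure_eq_zero_iff_ae_notMem.1 (volume_boundary p)
      filter_upwards [this] with x hxb
      rw [hreg]
      by_cases h : x ∉ p.boundary ℝ ∧ p.winding x = s
      · rw [Set.indicator_of_mem (show x ∈ {x | x ∉ p.boundary ℝ ∧ p.winding x = s} from h), h.2]
      · rw [Set.indicator_of_notMem (show x ∉ {x | x ∉ p.boundary ℝ ∧ p.winding x = s} from h)]
        rcases (hx x hxb).1 with h' | h'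
        · rw [h', Int.cast_zero]
        · exact absurd ⟨hxb, h'⟩ h
    rw [integral_congr_ae (ae_restrict_of_ae hae), setIntegral_indicator hmeas,
      Set.inter_eq_right.2 hsubH, setIntegral_const, smul_eq_mul, mul_comm]
  have hkey : |p.shoelace| = volume.real p.enclosedRegion := by
    rw [← hint1, hint2, abs_mul, abs_of_nonneg measureReal_nonneg]
    rcases hs with rfl | rfl <;> simp
  rw [hkey, area, Measure.real, ENNReal.ofReal_toReal hfin]

end Polygon

/-! ### The isoperimetric inequality for a path of four segments -/

/-- The two-dimensional cross product of complex numbers. -/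
def crossC (z w : ℂ) : ℝ := z.re * w.im - z.im * w.re

namespace Arc

/-- The signed area of the closed polygon `u 0, …, u 4`. -/
def area (u : Fin 5 → ℂ) : ℝ :=
  (crossC (u 0) (u 1) + crossC (u 1) (u 2) + crossC (u 2) (u 3) + crossC (u 3) (u 4) +
    crossC (u 4) (u 0)) / 2

/-- The length of the path `u 0, …, u 4`. -/
def len (u : Fin 5 → ℂ) : ℝ :=
  ‖u 1 - u 0‖ + ‖u 2 - u 1‖ + ‖u 3 - u 2‖ + ‖u 4 - u 3‖

/-- The energy of the path `u 0, …, u 4`. -/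
def energy (u : Fin 5 → ℂ) : ℝ :=
  ‖u 1 - u 0‖ ^ 2 + ‖u 2 - u 1‖ ^ 2 + ‖u 3 - u 2‖ ^ 2 + ‖u 4 - u 3‖ ^ 2

/-- The coefficient of the squared chord in the isoperimetric inequality. -/
def chordCoeff (t : ℝ) : ℝ := (1 - 6 * t ^ 2 + t ^ 4) / (4 * (1 - t ^ 2))

lemma sq_norm_eq (z : ℂ) : ‖z‖ ^ 2 = z.re ^ 2 + z.im ^ 2 := by
  rw [Complex.sq_norm, Complex.normSq_apply]; ring

/-- The discrepancy in the quadratic isoperimetric inequality is a sum of squares. -/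
lemma energy_eq {t : ℝ} (ht1 : 1 - t ^ 2 ≠ 0) (ht3 : 3 - t ^ 2 ≠ 0) (u : Fin 5 → ℂ) :
    energy u - 4 * t * area u - chordCoeff t * ‖u 4 - u 0‖ ^ 2 =
      2 * ‖(u 1 - u 0) - (1 - t * Complex.I) / 2 * (u 2 - u 0)‖ ^ 2 +
      (3 - t ^ 2) / 2 * ‖(u 2 - u 0) -
        ((2 / (3 - t ^ 2) : ℝ) : ℂ) * (1 - t * Complex.I) * (u 3 - u 0)‖ ^ 2 +
      4 * (1 - t ^ 2) / (3 - t ^ 2) * ‖(u 3 - u 0) -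
        (((3 - t ^ 2) / (4 * (1 - t ^ 2)) : ℝ) : ℂ) * (1 - t * Complex.I) * (u 4 - u 0)‖ ^ 2 := by
  simp only [energy, area, chordCoeff, crossC, sq_norm_eq]
  simp only [Complex.sub_re, Complex.sub_im, Complex.mul_re, Complex.mul_im, Complex.ofReal_re,
    Complex.ofReal_im, Complex.I_re, Complex.I_im, Complex.one_re, Complex.one_im,
    Complex.div_ofNat_re, Complex.div_ofNat_im]
  field_simp
  ring

lemma energy_ge {t : ℝ} (ht0 : 0 < t) (ht1 : t < 1) (u : Fin 5 → ℂ) :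
    4 * t * area u + chordCoeff t * ‖u 4 - u 0‖ ^ 2 ≤ energy u := by
  have h1 : 0 < 1 - t ^ 2 := by nlinarith
  have h3 : 0 < 3 - t ^ 2 := by linarith
  have := energy_eq h1.ne' h3.ne' u
  have : 0 ≤ energy u - 4 * t * area u - chordCoeff t * ‖u 4 - u 0‖ ^ 2 := by
    rw [this]; positivity
  linarith

/-- The extremal path with chord from `0` to `1`. -/
def extremal (t : ℝ) : Fin 5 → ℂ :=
  ![0, (1 - t * Complex.I) ^ 3 / (4 * (1 - t ^ 2)), (1 - t * Complex.I) ^ 2 / (2 * (1 - t ^ 2)),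
    (3 - t ^ 2) * (1 - t * Complex.I) / (4 * (1 - t ^ 2)), 1]

/-- Equality kills the three squares. The resulting linear relations determine `u 3`, `u 2` and `u
1` in turn from the chord. -/
lemma eq_extremal_of_energy_le {t : ℝ} (ht0 : 0 < t) (ht1 : t < 1) {u : Fin 5 → ℂ}
    (h : energy u ≤ 4 * t * area u + chordCoeff t * ‖u 4 - u 0‖ ^ 2) (k : Fin 5) :
    u k - u 0 = (u 4 - u 0) * extremal t k := by
  have h1 : 0 < 1 - t ^ 2 := by nlinarith
  have h3 : 0 < 3 - t ^ 2 := by linarith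
  have key := energy_eq h1.ne' h3.ne' u
  set A := (u 1 - u 0) - (1 - t * Complex.I) / 2 * (u 2 - u 0) with hA
  set B := (u 2 - u 0) - ((2 / (3 - t ^ 2) : ℝ) : ℂ) * (1 - t * Complex.I) * (u 3 - u 0) with hB
  set C := (u 3 - u 0) -
    (((3 - t ^ 2) / (4 * (1 - t ^ 2)) : ℝ) : ℂ) * (1 - t * Complex.I) * (u 4 - u 0) with hC
  have pA : 0 ≤ 2 * ‖A‖ ^ 2 := by positivity
  have pB : 0 ≤ (3 - t ^ 2) / 2 * ‖B‖ ^ 2 := by positivity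
  have pC : 0 ≤ 4 * (1 - t ^ 2) / (3 - t ^ 2) * ‖C‖ ^ 2 := by positivity
  have zero_of : ∀ (c : ℝ) (z : ℂ), 0 < c → c * ‖z‖ ^ 2 ≤ 0 → z = 0 := by
    intro c z hc hz
    have : ‖z‖ ^ 2 ≤ 0 := by by_contra! h'; nlinarith [mul_pos hc h']
    exact norm_eq_zero.1 (pow_eq_zero_iff two_ne_zero |>.1 (le_antisymm this (sq_nonneg _)))
  have eA := zero_of 2 A two_pos (by linarith)
  have eB := zero_of _ B (by positivity : 0 < (3 - t ^ 2) / 2) (by linarith)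
  have eC := zero_of _ C (by positivity : 0 < 4 * (1 - t ^ 2) / (3 - t ^ 2)) (by linarith)
  rw [hA, sub_eq_zero] at eA
  rw [hB, sub_eq_zero] at eB
  rw [hC, sub_eq_zero] at eC
  have c1 : (1 - (t : ℂ) ^ 2) ≠ 0 := by exact_mod_cast h1.ne'
  have c3 : (3 - (t : ℂ) ^ 2) ≠ 0 := by exact_mod_cast h3.ne'
  push_cast at eB eC
  fin_cases k
  · simp [extremal]
  · change u 1 - u 0 = (u 4 - u 0) * ((1 - t * Complex.I) ^ 3 / (4 * (1 - t ^ 2)))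
    rw [eA, eB, eC]; field_simp
  · change u 2 - u 0 = (u 4 - u 0) * ((1 - t * Complex.I) ^ 2 / (2 * (1 - t ^ 2)))
    rw [eB, eC]; field_simp; ring
  · change u 3 - u 0 = (u 4 - u 0) * ((3 - t ^ 2) * (1 - t * Complex.I) / (4 * (1 - t ^ 2)))
    rw [eC]; field_simp
  · simp [extremal]

/-- Among triangles of given base and height the isosceles one has least perimeter, strictly so
unless the triangle is isosceles or degenerate. In the degenerate case `β = 0` an apex inside the
base can slide without changing the length, which is why the equality case needs extra care. -/
lemma two_mul_sqrt_le (α β : ℝ) :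
    2 * √(1 / 4 + β ^ 2) ≤ √((1 / 2 + α) ^ 2 + β ^ 2) + √((1 / 2 - α) ^ 2 + β ^ 2) ∧
    (α ≠ 0 → β ≠ 0 →
      2 * √(1 / 4 + β ^ 2) < √((1 / 2 + α) ^ 2 + β ^ 2) + √((1 / 2 - α) ^ 2 + β ^ 2)) := by
  set a := √((1 / 2 + α) ^ 2 + β ^ 2) with ha
  set b := √((1 / 2 - α) ^ 2 + β ^ 2) with hb
  set r := √(1 / 4 + β ^ 2) with hr
  have ha2 : a ^ 2 = (1 / 2 + α) ^ 2 + β ^ 2 := Real.sq_sqrt (by positivity)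
  have hb2 : b ^ 2 = (1 / 2 - α) ^ 2 + β ^ 2 := Real.sq_sqrt (by positivity)
  have hr2 : r ^ 2 = 1 / 4 + β ^ 2 := Real.sq_sqrt (by positivity)
  have ha0 : 0 ≤ a := Real.sqrt_nonneg _
  have hb0 : 0 ≤ b := Real.sqrt_nonneg _
  have hab : (a * b) ^ 2 = (r ^ 2 - α ^ 2) ^ 2 + 4 * (α * β) ^ 2 := by
    rw [mul_pow, ha2, hb2, hr2]; ring
  have hsum : (a + b) ^ 2 = (2 * r) ^ 2 + 2 * (a * b - (r ^ 2 - α ^ 2)) := by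
    linear_combination ha2 + hb2 - 2 * hr2
  constructor
  · refine abs_le_of_sq_le_sq' ?_ (by positivity) |>.2
    have := abs_le_of_sq_le_sq' (a := r ^ 2 - α ^ 2) (b := a * b)
      (by rw [hab]; nlinarith [sq_nonneg (α * β)]) (by positivity) |>.2
    rw [hsum]; linarith
  · intro h1 h2
    refine lt_of_pow_lt_pow_left₀ 2 (by positivity) ?_
    have : r ^ 2 - α ^ 2 < a * b := by
      refine lt_of_pow_lt_pow_left₀ 2 (by positivity) ?_
      rw [hab]
      have : 0 < (α * β) ^ 2 := by positivity
      linarith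
    rw [hsum]; linarith

lemma norm_half_add (D : ℂ) (α β : ℝ) :
    ‖(1 / 2 + (α + β * Complex.I)) * D‖ = √((1 / 2 + α) ^ 2 + β ^ 2) * ‖D‖ := by
  rw [norm_mul]
  congr 1
  rw [eq_comm, Real.sqrt_eq_iff_mul_self_eq (by positivity) (norm_nonneg _), ← sq, sq_norm_eq]
  simp

lemma norm_half_sub (D : ℂ) (α β : ℝ) :
    ‖(1 / 2 - (α + β * Complex.I)) * D‖ = √((1 / 2 - α) ^ 2 + β ^ 2) * ‖D‖ := by
  have := norm_half_add D (-α) (-β)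
  push_cast at this
  rw [show (1 / 2 - (α + β * Complex.I)) = (1 / 2 + (-α + -β * Complex.I)) by ring, this]
  ring_nf

/-- The point with coordinates `α, β` in the frame of the chord `P Q`, with origin its midpoint. -/
def framePoint (P Q : ℂ) (α β : ℝ) : ℂ := (P + Q) / 2 + (α + β * Complex.I) * (Q - P)

lemma exists_framePoint {P Q : ℂ} (h : P ≠ Q) (X : ℂ) : ∃ α β : ℝ, X = framePoint P Q α β := by
  have hD : Q - P ≠ 0 := sub_ne_zero.2 h.symm
  refine ⟨((X - (P + Q) / 2) / (Q - P)).re, ((X - (P + Q) / 2) / (Q - P)).im, ?_⟩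
  rw [framePoint, Complex.re_add_im, div_mul_cancel₀ _ hD]; ring

lemma norm_framePoint_sub (P Q : ℂ) (α β : ℝ) :
    ‖framePoint P Q α β - P‖ = √((1 / 2 + α) ^ 2 + β ^ 2) * ‖Q - P‖ := by
  rw [← norm_half_add]; congr 1; rw [framePoint]; ring

lemma norm_sub_framePoint (P Q : ℂ) (α β : ℝ) :
    ‖Q - framePoint P Q α β‖ = √((1 / 2 - α) ^ 2 + β ^ 2) * ‖Q - P‖ := by
  rw [← norm_half_sub]; congr 1; rw [framePoint]; ring

lemma crossC_framePoint (P Q : ℂ) (α β : ℝ) :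
    crossC P (framePoint P Q α β) + crossC (framePoint P Q α β) Q =
      crossC P Q - β * ‖Q - P‖ ^ 2 := by
  simp only [crossC, framePoint, sq_norm_eq]
  simp only [Complex.add_re, Complex.add_im, Complex.sub_re, Complex.sub_im, Complex.mul_re,
    Complex.mul_im, Complex.ofReal_re, Complex.ofReal_im, Complex.I_re, Complex.I_im,
    Complex.div_ofNat_re, Complex.div_ofNat_im]
  ring

/-- Making two adjacent lengths equal without changing the area or increasing the length lowers the
energy. -/
lemma exists_balanced {P X Q : ℂ} (h : ‖X - P‖ ≠ ‖Q - X‖) :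
    ∃ X', crossC P X' + crossC X' Q = crossC P X + crossC X Q ∧
      ‖X' - P‖ + ‖Q - X'‖ ≤ ‖X - P‖ + ‖Q - X‖ ∧
      ‖X' - P‖ ^ 2 + ‖Q - X'‖ ^ 2 < ‖X - P‖ ^ 2 + ‖Q - X‖ ^ 2 := by
  have hPQ : P ≠ Q := by rintro rfl; exact h (norm_sub_rev _ _)
  have hD : 0 < ‖Q - P‖ := norm_pos_iff.2 (sub_ne_zero.2 hPQ.symm)
  obtain ⟨α, β, rfl⟩ := exists_framePoint hPQ X
  rw [norm_framePoint_sub, norm_sub_framePoint] at h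
  have hα : α ≠ 0 := by rintro rfl; exact h (by ring_nf)
  refine ⟨framePoint P Q 0 β, by rw [crossC_framePoint, crossC_framePoint], ?_, ?_⟩
  · simp only [norm_framePoint_sub, norm_sub_framePoint]
    have := mul_le_mul_of_nonneg_right (two_mul_sqrt_le α β).1 hD.le
    have e : (1 / 2 : ℝ) ^ 2 = 1 / 4 := by norm_num
    rw [add_zero, sub_zero, e]; linarith
  · simp only [norm_framePoint_sub, norm_sub_framePoint, mul_pow]
    rw [Real.sq_sqrt (by positivity), Real.sq_sqrt (by positivity), Real.sq_sqrt (by positivity),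
      Real.sq_sqrt (by positivity)]
    have : 0 < α ^ 2 * ‖Q - P‖ ^ 2 := by positivity
    linarith

/-- If two adjacent lengths differ, then the path can be shortened at constant area, or it can be
bent so that the gain of length is of lower order than the gain of area. -/
lemma exists_shorter_or_bent {P X Q : ℂ} (h : ‖X - P‖ ≠ ‖Q - X‖) :
    (∃ X', crossC P X' + crossC X' Q = crossC P X + crossC X Q ∧
      ‖X' - P‖ + ‖Q - X'‖ < ‖X - P‖ + ‖Q - X‖) ∨
    ∃ d : ℝ, 0 < d ∧ ∀ η : ℝ, 0 < η → ∃ X',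
      crossC P X' + crossC X' Q = crossC P X + crossC X Q + η * d ^ 2 ∧
      ‖X' - P‖ + ‖Q - X'‖ ≤ ‖X - P‖ + ‖Q - X‖ + 2 * d * η ^ 2 := by
  have hPQ : P ≠ Q := by rintro rfl; exact h (norm_sub_rev _ _)
  have hD : 0 < ‖Q - P‖ := norm_pos_iff.2 (sub_ne_zero.2 hPQ.symm)
  obtain ⟨α, β, rfl⟩ := exists_framePoint hPQ X
  rw [norm_framePoint_sub, norm_sub_framePoint] at h
  have hα : α ≠ 0 := by rintro rfl; exact h (by ring_nf)
  have e : (1 / 2 : ℝ) ^ 2 = 1 / 4 := by norm_num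
  by_cases hβ : β = 0
  · right
    refine ⟨‖Q - P‖, hD, fun η hη => ⟨framePoint P Q 0 (-η), ?_, ?_⟩⟩
    · rw [crossC_framePoint, crossC_framePoint, hβ]; ring
    · have h1 : ‖Q - P‖ ≤ ‖framePoint P Q α β - P‖ + ‖Q - framePoint P Q α β‖ := by
        rw [add_comm]; exact norm_sub_le_norm_sub_add_norm_sub _ _ _
      rw [norm_framePoint_sub P Q 0, norm_sub_framePoint P Q 0, add_zero, sub_zero, e]
      have h2 : √(1 / 4 + (-η) ^ 2) ≤ 1 / 2 + η ^ 2 := by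
        rw [Real.sqrt_le_left (by positivity)]; nlinarith [sq_nonneg (η ^ 2)]
      have := mul_le_mul_of_nonneg_right h2 hD.le
      linarith
  · left
    refine ⟨framePoint P Q 0 β, by rw [crossC_framePoint, crossC_framePoint], ?_⟩
    simp only [norm_framePoint_sub, norm_sub_framePoint]
    have := mul_lt_mul_of_pos_right ((two_mul_sqrt_le α β).2 hα hβ) hD
    rw [add_zero, sub_zero, e]; linarith

lemma area_update (u : Fin 5 → ℂ) (X : ℂ) :
    (2 * area (Function.update u 1 X) = 2 * area u - (crossC (u 0) (u 1) + crossC (u 1) (u 2)) +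
      (crossC (u 0) X + crossC X (u 2))) ∧
    (2 * area (Function.update u 2 X) = 2 * area u - (crossC (u 1) (u 2) + crossC (u 2) (u 3)) +
      (crossC (u 1) X + crossC X (u 3))) ∧
    (2 * area (Function.update u 3 X) = 2 * area u - (crossC (u 2) (u 3) + crossC (u 3) (u 4)) +
      (crossC (u 2) X + crossC X (u 4))) := by
  refine ⟨?_, ?_, ?_⟩ <;> simp [area, Function.update] <;> ring

lemma len_update (u : Fin 5 → ℂ) (X : ℂ) :
    (len (Function.update u 1 X) = len u - (‖u 1 - u 0‖ + ‖u 2 - u 1‖) +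
      (‖X - u 0‖ + ‖u 2 - X‖)) ∧
    (len (Function.update u 2 X) = len u - (‖u 2 - u 1‖ + ‖u 3 - u 2‖) +
      (‖X - u 1‖ + ‖u 3 - X‖)) ∧
    (len (Function.update u 3 X) = len u - (‖u 3 - u 2‖ + ‖u 4 - u 3‖) +
      (‖X - u 2‖ + ‖u 4 - X‖)) := by
  refine ⟨?_, ?_, ?_⟩ <;> simp [len, Function.update] <;> ring

lemma energy_update (u : Fin 5 → ℂ) (X : ℂ) :
    (energy (Function.update u 1 X) = energy u - (‖u 1 - u 0‖ ^ 2 + ‖u 2 - u 1‖ ^ 2) +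
      (‖X - u 0‖ ^ 2 + ‖u 2 - X‖ ^ 2)) ∧
    (energy (Function.update u 2 X) = energy u - (‖u 2 - u 1‖ ^ 2 + ‖u 3 - u 2‖ ^ 2) +
      (‖X - u 1‖ ^ 2 + ‖u 3 - X‖ ^ 2)) ∧
    (energy (Function.update u 3 X) = energy u - (‖u 3 - u 2‖ ^ 2 + ‖u 4 - u 3‖ ^ 2) +
      (‖X - u 2‖ ^ 2 + ‖u 4 - X‖ ^ 2)) := by
  refine ⟨?_, ?_, ?_⟩ <;> simp [energy, Function.update] <;> ring

/-- All four lengths of the path agree. -/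
def IsEquilateral (u : Fin 5 → ℂ) : Prop :=
  ‖u 1 - u 0‖ = ‖u 2 - u 1‖ ∧ ‖u 2 - u 1‖ = ‖u 3 - u 2‖ ∧ ‖u 3 - u 2‖ = ‖u 4 - u 3‖

lemma continuous_area : Continuous area := by
  unfold area crossC; fun_prop

lemma continuous_len : Continuous len := by
  unfold len; fun_prop

lemma continuous_energy : Continuous energy := by
  unfold energy; fun_prop

lemma energy_nonneg (u : Fin 5 → ℂ) : 0 ≤ energy u := by
  unfold energy; positivity

lemma len_nonneg (u : Fin 5 → ℂ) : 0 ≤ len u := by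
  unfold len; positivity

lemma norm_le_of_len_le {u : Fin 5 → ℂ} {L : ℝ} (h : len u ≤ L) (k : Fin 5) :
    ‖u k‖ ≤ ‖u 0‖ + L := by
  have n1 := norm_nonneg (u 1 - u 0)
  have n2 := norm_nonneg (u 2 - u 1)
  have n3 := norm_nonneg (u 3 - u 2)
  have n4 := norm_nonneg (u 4 - u 3)
  have t1 := norm_sub_norm_le (u 1) (u 0)
  have t2 := norm_sub_norm_le (u 2) (u 1)
  have t3 := norm_sub_norm_le (u 3) (u 2)
  have t4 := norm_sub_norm_le (u 4) (u 3)
  unfold len at h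
  fin_cases k <;> simp only [Fin.zero_eta, Fin.mk_one, Fin.reduceFinMk] <;> linarith

/-- A minimizer of `len + ε · energy` over paths with the same ends and at least the same area
exists by compactness. Length alone would not do, since a vertex inside a straight stretch can slide
at no cost; the energy term makes balancing strictly profitable. -/
lemma exists_equilateral (u : Fin 5 → ℂ) {ε : ℝ} (hε : 0 < ε) :
    ∃ m : Fin 5 → ℂ, m 0 = u 0 ∧ m 4 = u 4 ∧ area u ≤ area m ∧
      len m + ε * energy m ≤ len u + ε * energy u ∧ IsEquilateral m := by
  set F : (Fin 5 → ℂ) → ℝ := fun m => len m + ε * energy m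
  have hF : Continuous F := continuous_len.add (continuous_const.mul continuous_energy)
  set K : Set (Fin 5 → ℂ) := {m | m 0 = u 0 ∧ m 4 = u 4 ∧ area u ≤ area m ∧ F m ≤ F u}
  have hKc : IsClosed K :=
    (isClosed_eq (continuous_apply 0) continuous_const).inter
      ((isClosed_eq (continuous_apply 4) continuous_const).inter
        ((isClosed_le continuous_const continuous_area).inter (isClosed_le hF continuous_const)))
  have hKb : Bornology.IsBounded K := by
    rw [isBounded_iff_forall_norm_le]
    refine ⟨‖u 0‖ + F u, fun m hm => ?_⟩
    have h1 : len m ≤ F u := by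
      have := mul_nonneg hε.le (energy_nonneg m)
      have := hm.2.2.2
      simp only [F] at this ⊢; linarith
    have h2 := norm_le_of_len_le h1
    rw [hm.1] at h2
    exact (pi_norm_le_iff_of_nonneg ((norm_nonneg _).trans (h2 0))).2 h2
  obtain ⟨m, hm, hmin⟩ := (Metric.isCompact_of_isClosed_isBounded hKc hKb).exists_isMinOn
    ⟨u, rfl, rfl, le_rfl, le_rfl⟩ hF.continuousOn
  refine ⟨m, hm.1, hm.2.1, hm.2.2.1, hm.2.2.2, ?_⟩
  -- No admissible change may lower the energy without raising the length; balancing two unequal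
  -- neighbours would do just that.
  have key : ∀ m', m' 0 = m 0 → m' 4 = m 4 → area m' = area m → len m' ≤ len m →
      ¬ energy m' < energy m := by
    intro m' h0 h4 ha hl he
    have hlt : F m' < F m := by
      have := mul_lt_mul_of_pos_left he hε
      simp only [F]; linarith
    have := hmin (a := m') ⟨h0.trans hm.1, h4.trans hm.2.1, ha ▸ hm.2.2.1,
      hlt.le.trans hm.2.2.2⟩
    exact absurd hlt (not_lt.2 this)
  refine ⟨?_, ?_, ?_⟩ <;> by_contra hne <;> obtain ⟨X, h1, h2, h3⟩ := exists_balanced hne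
  · refine key (Function.update m 1 X) (by simp) (by simp) ?_ ?_ ?_
    · linarith [(area_update m X).1]
    · linarith [(len_update m X).1]
    · linarith [(energy_update m X).1]
  · refine key (Function.update m 2 X) (by simp) (by simp) ?_ ?_ ?_
    · linarith [(area_update m X).2.1]
    · linarith [(len_update m X).2.1]
    · linarith [(energy_update m X).2.1]
  · refine key (Function.update m 3 X) (by simp) (by simp) ?_ ?_ ?_
    · linarith [(area_update m X).2.2]
    · linarith [(len_update m X).2.2]
    · linarith [(energy_update m X).2.2]

lemma IsEquilateral.four_mul_energy {u : Fin 5 → ℂ} (h : IsEquilateral u) :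
    4 * energy u = len u ^ 2 := by
  obtain ⟨h1, h2, h3⟩ := h
  simp only [energy, len, h1, h2, h3]; ring

/-- The isoperimetric inequality for a path of four segments with given end points. -/
theorem len_sq_ge {t : ℝ} (ht0 : 0 < t) (ht1 : t < 1) (u : Fin 5 → ℂ) :
    16 * t * area u + 4 * chordCoeff t * ‖u 4 - u 0‖ ^ 2 ≤ len u ^ 2 := by
  set q := 16 * t * area u + 4 * chordCoeff t * ‖u 4 - u 0‖ ^ 2 with hq
  suffices h : √q ≤ len u by
    exact (Real.sqrt_le_left (len_nonneg u)).1 h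
  refine le_of_forall_pos_le_add fun δ hδ => ?_
  have hE := energy_nonneg u
  -- This weight keeps the energy term of `u` below `δ`, so the bound for the equilateral path `m`
  -- passes to `u` up to `δ`.
  obtain ⟨m, h0, h4, ha, hF, he⟩ := exists_equilateral u (ε := δ / (energy u + 1)) (by positivity)
  have hm := energy_ge ht0 ht1 m
  rw [h0, h4] at hm
  have hqm : q ≤ len m ^ 2 := by
    rw [← he.four_mul_energy, hq]
    have := mul_le_mul_of_nonneg_left ha ht0.le
    linarith
  have h1 : √q ≤ len m := (Real.sqrt_le_left (len_nonneg m)).2 hqm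
  have h2 : 0 ≤ δ / (energy u + 1) * energy m := mul_nonneg (by positivity) (energy_nonneg m)
  have h3 : δ / (energy u + 1) * energy u ≤ δ := by
    rw [div_mul_eq_mul_div, div_le_iff₀ (by linarith)]; nlinarith
  linarith

/-- Equality in the isoperimetric inequality forces the extremal path. -/
theorem eq_extremal_of_len_sq_le {t : ℝ} (ht0 : 0 < t) (ht1 : t < 1) {u : Fin 5 → ℂ}
    (h : len u ^ 2 ≤ 16 * t * area u + 4 * chordCoeff t * ‖u 4 - u 0‖ ^ 2) (k : Fin 5) :
    u k - u 0 = (u 4 - u 0) * extremal t k := by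
  have hL := len_nonneg u
  have shorter : ∀ m, m 0 = u 0 → m 4 = u 4 → area m = area u → ¬ len m < len u := by
    intro m h0 h4 ha hl
    have h1 := len_sq_ge ht0 ht1 m
    rw [h0, h4, ha] at h1
    nlinarith [len_nonneg m]
  have bent : ∀ d : ℝ, 0 < d → ¬ ∀ η : ℝ, 0 < η → ∃ m, m 0 = u 0 ∧ m 4 = u 4 ∧
      2 * area m = 2 * area u + η * d ^ 2 ∧ len m ≤ len u + 2 * d * η ^ 2 := by
    intro d hd hη
    -- Bending gains area of first order in `η` and costs length of second order. The inequality for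
    -- the bent path would give `2td ≤ (len u + d) η`, while this `η` makes the right side at most
    -- `td`.
    set η := min 1 (t * d / (len u + d)) with hη'
    have p1 : 0 < η := lt_min one_pos (by positivity)
    have p2 : η ≤ 1 := min_le_left _ _
    have p3 : (len u + d) * η ≤ t * d := by
      have : η ≤ t * d / (len u + d) := min_le_right _ _
      rw [le_div_iff₀ (by positivity)] at this
      linarith
    obtain ⟨m, h0, h4, ha, hl⟩ := hη η p1
    have h1 := len_sq_ge ht0 ht1 m
    rw [h0, h4] at h1
    have h2 : len m ^ 2 ≤ (len u + 2 * d * η ^ 2) ^ 2 :=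
      pow_le_pow_left₀ (len_nonneg m) hl 2
    have h3 : 8 * t * (η * d ^ 2) ≤ 4 * d * η * (len u * η + d * η ^ 3) := by
      have : 16 * t * area m = 16 * t * area u + 8 * t * (η * d ^ 2) := by
        linear_combination 8 * t * ha
      linarith
    have h4 : 2 * t * d ≤ len u * η + d * η ^ 3 := by
      have : 4 * d * η * (2 * t * d) ≤ 4 * d * η * (len u * η + d * η ^ 3) := by linarith
      exact le_of_mul_le_mul_left this (by positivity)
    have h5 : η ^ 3 ≤ η := by
      have : η ^ 3 = η * η ^ 2 := by ring
      rw [this]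
      exact mul_le_of_le_one_right p1.le (pow_le_one₀ p1.le p2)
    nlinarith [mul_pos ht0 hd]
  have heq : IsEquilateral u := by
    refine ⟨?_, ?_, ?_⟩ <;> by_contra hne <;>
      rcases exists_shorter_or_bent hne with ⟨X, h1, h2⟩ | ⟨d, hd, hη⟩
    · exact shorter (Function.update u 1 X) (by simp) (by simp)
        (by linarith [(area_update u X).1]) (by linarith [(len_update u X).1])
    · refine bent d hd fun η h0 => ?_
      obtain ⟨X, h1, h2⟩ := hη η h0
      exact ⟨Function.update u 1 X, by simp, by simp,
        by linarith [(area_update u X).1], by linarith [(len_update u X).1]⟩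
    · exact shorter (Function.update u 2 X) (by simp) (by simp)
        (by linarith [(area_update u X).2.1]) (by linarith [(len_update u X).2.1])
    · refine bent d hd fun η h0 => ?_
      obtain ⟨X, h1, h2⟩ := hη η h0
      exact ⟨Function.update u 2 X, by simp, by simp,
        by linarith [(area_update u X).2.1], by linarith [(len_update u X).2.1]⟩
    · exact shorter (Function.update u 3 X) (by simp) (by simp)
        (by linarith [(area_update u X).2.2]) (by linarith [(len_update u X).2.2])
    · refine bent d hd fun η h0 => ?_
      obtain ⟨X, h1, h2⟩ := hη η h0
      exact ⟨Function.update u 3 X, by simp, by simp,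
        by linarith [(area_update u X).2.2], by linarith [(len_update u X).2.2]⟩
  refine eq_extremal_of_energy_le ht0 ht1 ?_ k
  have := heq.four_mul_energy
  linarith

end Arc

/-! ### Extremal paths as equal steps on a circle -/

namespace Arc

/-- The path is similar to the extremal path with parameter `t`. -/
def IsExtremal (t : ℝ) (u : Fin 5 → ℂ) : Prop :=
  ∀ k, u k - u 0 = (u 4 - u 0) * extremal t k

section

variable (t : ℝ)

/-- `1 - t i` -/
def zm : ℂ := 1 - t * Complex.I

/-- `1 + t i` -/
def zp : ℂ := 1 + t * Complex.I

lemma zp_add_zm : zp t + zm t = 2 := by simp only [zp, zm]; ring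

lemma zp_mul_zm : zp t * zm t = 1 + t ^ 2 := by
  simp only [zp, zm]; linear_combination (- (t : ℂ) ^ 2) * Complex.I_sq

lemma zp_sq_add_zm_sq : zp t ^ 2 + zm t ^ 2 = 2 * (1 - t ^ 2) := by
  simp only [zp, zm]; linear_combination (2 * (t : ℂ) ^ 2) * Complex.I_sq

lemma zp_sub_zm : zp t - zm t = 2 * t * Complex.I := by simp only [zp, zm]; ring

lemma sq_norm_zm : ‖zm t‖ ^ 2 = 1 + t ^ 2 := by rw [sq_norm_eq]; simp [zm]

lemma norm_zp : ‖zp t‖ = ‖zm t‖ := by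
  rw [← sq_eq_sq₀ (norm_nonneg _) (norm_nonneg _), sq_norm_zm, sq_norm_eq]; simp [zp]

lemma zm_ne_zero : zm t ≠ 0 := by
  intro h
  have := sq_norm_zm t
  rw [h] at this
  simp at this
  nlinarith [sq_nonneg t]

lemma extremal_zero : extremal t 0 = 0 := rfl
lemma extremal_one : extremal t 1 = zm t ^ 3 / (4 * (1 - t ^ 2)) := rfl
lemma extremal_two : extremal t 2 = zm t ^ 2 / (2 * (1 - t ^ 2)) := rfl
lemma extremal_three : extremal t 3 = (3 - t ^ 2) * zm t / (4 * (1 - t ^ 2)) := rfl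
lemma extremal_four : extremal t 4 = 1 := rfl

end

lemma cast_one_sub_sq_ne {t : ℝ} (h : 1 - t ^ 2 ≠ 0) : (1 - (t : ℂ) ^ 2) ≠ 0 := by
  exact_mod_cast h

/-- With `t = tan θ` the number `ω` is `exp (2 i θ)`, so the extremal path is the image of `1, ω, …,
ω ^ 4` under the similarity that takes `1` to `0` and `ω ^ 4` to `1`. The form without division also
covers `t = 0`, where `ω ^ 4 = 1`. -/
lemma extremal_mul {t : ℝ} (h : 1 - t ^ 2 ≠ 0) {ω : ℂ} (hω : ω * zm t = zp t) (k : Fin 5) :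
    ω ^ (k : ℕ) - 1 = (ω ^ 4 - 1) * extremal t k := by
  have h' := cast_one_sub_sq_ne h
  have hz := zm_ne_zero t
  have s1 := zp_add_zm t
  have s2 := zp_mul_zm t
  have s3 := zp_sq_add_zm_sq t
  obtain rfl : ω = zp t / zm t := by rw [eq_div_iff hz, hω]
  fin_cases k
  · simp [extremal_zero]
  · simp only [Fin.mk_one, pow_one, extremal_one]
    field_simp
    linear_combination (zp t - zm t) * (-(zp t + zm t) * s3 - 2 * (1 - (t : ℂ) ^ 2) * s1)
  · simp only [Fin.reduceFinMk, extremal_two]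
    field_simp
    linear_combination -(zp t ^ 2 - zm t ^ 2) * s3
  · simp only [Fin.reduceFinMk, extremal_three]
    field_simp
    have s4 : zp t ^ 2 + zp t * zm t + zm t ^ 2 = 3 - t ^ 2 := by linear_combination s2 + s3
    have e : zp t ^ 4 - zm t ^ 4 = (zp t - zm t) * (4 * (1 - (t : ℂ) ^ 2)) := by
      linear_combination (zp t - zm t) * ((zp t + zm t) * s3 + 2 * (1 - (t : ℂ) ^ 2) * s1)
    linear_combination 4 * (1 - (t : ℂ) ^ 2) * (zp t - zm t) * s4 - (3 - (t : ℂ) ^ 2) * e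
  · simp [extremal_four]

lemma exists_center {t : ℝ} (ht : 0 < t) (h : 1 - t ^ 2 ≠ 0) :
    ∃ c : ℂ, ∀ k, ‖extremal t k - c‖ = ‖c‖ := by
  have hz := zm_ne_zero t
  set ω := zp t / zm t with hω
  have hωz : ω * zm t = zp t := div_mul_cancel₀ _ hz
  have hω1 : ‖ω‖ = 1 := by
    rw [hω, norm_div, norm_zp, div_self (norm_ne_zero_iff.2 hz)]
  have hne : ω ^ 4 - 1 ≠ 0 := by
    intro h0
    have h1 := extremal_mul h hωz 1
    rw [h0, zero_mul] at h1
    have h2 : ω = 1 := by simpa [sub_eq_zero] using h1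
    rw [h2, one_mul] at hωz
    have := zp_sub_zm t
    rw [← hωz, sub_self] at this
    simp [ht.ne'] at this
  -- The centre is the image of the origin under the similarity `w ↦ (w - 1) / (ω ^ 4 - 1)`.
  refine ⟨-1 / (ω ^ 4 - 1), fun k => ?_⟩
  have hk := extremal_mul h hωz k
  have : extremal t k - -1 / (ω ^ 4 - 1) = ω ^ (k : ℕ) * (1 / (ω ^ 4 - 1)) := by
    field_simp
    linear_combination -hk
  rw [this, norm_mul, norm_pow, hω1, one_pow, one_mul, neg_div, norm_neg]

/-- The successive edges are `zm ^ (3 - k) * zp ^ k / (4 (1 - t²))`, and `zm` and `zp` have the same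
norm. -/
lemma isEquilateral_extremal {t : ℝ} (h : 1 - t ^ 2 ≠ 0) :
    IsEquilateral (extremal t) ∧
      ‖extremal t 1 - extremal t 0‖ = ‖zm t‖ ^ 3 / (4 * |1 - t ^ 2|) := by
  have h' := cast_one_sub_sq_ne h
  have s1 := zp_add_zm t
  have s2 := zp_mul_zm t
  have s3 := zp_sq_add_zm_sq t
  have hn : ‖(4 * (1 - (t : ℂ) ^ 2))‖ = 4 * |1 - t ^ 2| := by
    rw [norm_mul, ← Complex.ofReal_pow, ← Complex.ofReal_one, ← Complex.ofReal_sub,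
      Complex.norm_real, Real.norm_eq_abs, Complex.norm_ofNat]
  have e1 : extremal t 1 - extremal t 0 = zm t ^ 3 / (4 * (1 - t ^ 2)) := by
    rw [extremal_one, extremal_zero, sub_zero]
  have e2 : extremal t 2 - extremal t 1 = zm t ^ 2 * zp t / (4 * (1 - t ^ 2)) := by
    rw [extremal_two, extremal_one]; field_simp
    linear_combination (-2 * zm t ^ 2) * s1
  have e3 : extremal t 3 - extremal t 2 = zm t * zp t ^ 2 / (4 * (1 - t ^ 2)) := by
    rw [extremal_three, extremal_two]; field_simp
    linear_combination (-2 * zm t) * (s2 + s3) + 2 * zm t ^ 2 * s1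
  have e4 : extremal t 4 - extremal t 3 = zp t ^ 3 / (4 * (1 - t ^ 2)) := by
    rw [extremal_four, extremal_three]; field_simp
    linear_combination -2 * s3 + zm t * (s2 + s3) - (zp t ^ 2 + zm t ^ 2) * s1
  refine ⟨⟨?_, ?_, ?_⟩, ?_⟩
  · rw [e1, e2]; simp only [norm_div, norm_mul, norm_pow, norm_zp]; ring
  · rw [e2, e3]; simp only [norm_div, norm_mul, norm_pow, norm_zp]; ring
  · rw [e3, e4]; simp only [norm_div, norm_mul, norm_pow, norm_zp]; ring
  · rw [e1, norm_div, norm_pow, hn]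

lemma IsExtremal.sub {t : ℝ} {u : Fin 5 → ℂ} (h : IsExtremal t u) (a b : Fin 5) :
    u a - u b = (u 4 - u 0) * (extremal t a - extremal t b) := by
  linear_combination h a - h b

lemma IsExtremal.isEquilateral {t : ℝ} (h1 : 1 - t ^ 2 ≠ 0) {u : Fin 5 → ℂ}
    (h : IsExtremal t u) : IsEquilateral u := by
  obtain ⟨⟨e1, e2, e3⟩, -⟩ := isEquilateral_extremal h1
  refine ⟨?_, ?_, ?_⟩
  · rw [h.sub 1 0, h.sub 2 1, norm_mul, norm_mul, e1]
  · rw [h.sub 2 1, h.sub 3 2, norm_mul, norm_mul, e2]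
  · rw [h.sub 3 2, h.sub 4 3, norm_mul, norm_mul, e3]

lemma IsExtremal.energy_eq {t : ℝ} (ht0 : 0 < t) (ht1 : t < 1) {u : Fin 5 → ℂ}
    (h : IsExtremal t u) : energy u = 4 * t * area u + chordCoeff t * ‖u 4 - u 0‖ ^ 2 := by
  have h1 : 1 - t ^ 2 ≠ 0 := by nlinarith
  have h3 : 3 - t ^ 2 ≠ 0 := by nlinarith
  have key := Arc.energy_eq h1 h3 u
  have c1 := cast_one_sub_sq_ne h1
  have c3 : (3 - (t : ℂ) ^ 2) ≠ 0 := by exact_mod_cast h3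
  have eA : (u 1 - u 0) - (1 - t * Complex.I) / 2 * (u 2 - u 0) = 0 := by
    rw [h 1, h 2, extremal_one, extremal_two, zm]; field_simp; ring
  have eB : (u 2 - u 0) -
      ((2 / (3 - t ^ 2) : ℝ) : ℂ) * (1 - t * Complex.I) * (u 3 - u 0) = 0 := by
    rw [h 2, h 3, extremal_two, extremal_three, zm]; push_cast; field_simp; ring
  have eC : (u 3 - u 0) - (((3 - t ^ 2) / (4 * (1 - t ^ 2)) : ℝ) : ℂ) * (1 - t * Complex.I) *
      (u 4 - u 0) = 0 := by
    rw [h 3, extremal_three, zm]; push_cast; field_simp; ring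
  rw [eA, eB, eC] at key
  simp only [norm_zero] at key
  linarith

lemma IsExtremal.len_sq {t : ℝ} (ht0 : 0 < t) (ht1 : t < 1) {u : Fin 5 → ℂ}
    (h : IsExtremal t u) :
    len u ^ 2 = 16 * t * area u + 4 * chordCoeff t * ‖u 4 - u 0‖ ^ 2 := by
  have h1 : 1 - t ^ 2 ≠ 0 := by nlinarith
  rw [← (h.isEquilateral h1).four_mul_energy, h.energy_eq ht0 ht1]; ring

/-- The area is read off from equality in the energy inequality, as the energy is four times the
square of the known edge length. -/
lemma area_extremal {t : ℝ} (ht0 : 0 < t) (ht1 : t < 1) :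
    area (extremal t) = t * (5 - 2 * t ^ 2 + t ^ 4) / (8 * (1 - t ^ 2) ^ 2) := by
  have h1 : 0 < 1 - t ^ 2 := by nlinarith
  have hext : IsExtremal t (extremal t) := fun k => by
    rw [extremal_zero, extremal_four]; ring
  have key := hext.energy_eq ht0 ht1
  obtain ⟨⟨e1, e2, e3⟩, e0⟩ := isEquilateral_extremal h1.ne'
  have hen : energy (extremal t) = 4 * ((1 + t ^ 2) ^ 3 / (4 * (1 - t ^ 2)) ^ 2) := by
    have : (‖zm t‖ ^ 3 / (4 * |1 - t ^ 2|)) ^ 2 = (1 + t ^ 2) ^ 3 / (4 * (1 - t ^ 2)) ^ 2 := by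
      rw [abs_of_pos h1, div_pow, ← sq_norm_zm]; ring
    rw [← this, ← e0, energy, ← e3, ← e2, ← e1]; ring
  rw [hen, extremal_zero, extremal_four, chordCoeff] at key
  have ht : t ≠ 0 := ht0.ne'
  simp only [sub_zero, norm_one, one_pow, mul_one] at key
  have h2 : area (extremal t) = (4 * ((1 + t ^ 2) ^ 3 / (4 * (1 - t ^ 2)) ^ 2) -
      (1 - 6 * t ^ 2 + t ^ 4) / (4 * (1 - t ^ 2))) / (4 * t) := by
    rw [eq_div_iff (by positivity), key]; ring
  rw [h2]
  have := h1.ne'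
  field_simp
  ring

/-- There is an extremal path with chord `e` and area `1`. -/
lemma exists_parameter {e : ℝ} (he : 0 < e) :
    ∃ t : ℝ, 0 < t ∧ t < 1 ∧ e ^ 2 * area (extremal t) = 1 := by
  -- This is the equation for unit area with denominators cleared; `f 0 = -8` and `f 1 = 4 e²`.
  set f : ℝ → ℝ := fun t => e ^ 2 * t * (5 - 2 * t ^ 2 + t ^ 4) - 8 * (1 - t ^ 2) ^ 2
  have hf : Continuous f := by fun_prop
  obtain ⟨t, ht, hft⟩ : (0 : ℝ) ∈ f '' Set.Ioo 0 1 := by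
    refine intermediate_value_Ioo zero_le_one hf.continuousOn ⟨?_, ?_⟩
    · norm_num [f]
    · norm_num [f]; positivity
  refine ⟨t, ht.1, ht.2, ?_⟩
  have h1 : 0 < 1 - t ^ 2 := by nlinarith [ht.1, ht.2]
  rw [area_extremal ht.1 ht.2, ← mul_div_assoc, div_eq_one_iff_eq (by positivity)]
  simp only [f] at hft
  linarith

lemma crossC_conj (z w : ℂ) :
    crossC ((starRingEnd ℂ) z) ((starRingEnd ℂ) w) = - crossC z w := by
  simp [crossC]; ring

lemma norm_conj_sub (z w : ℂ) : ‖(starRingEnd ℂ) z - (starRingEnd ℂ) w‖ = ‖z - w‖ := by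
  rw [← map_sub, RCLike.norm_conj]

/-- The mirror image of a path. -/
def conj (u : Fin 5 → ℂ) : Fin 5 → ℂ := fun k => (starRingEnd ℂ) (u k)

lemma area_conj (u : Fin 5 → ℂ) : area (conj u) = - area u := by
  simp only [area, conj, crossC_conj]; ring

lemma len_conj (u : Fin 5 → ℂ) : len (conj u) = len u := by
  simp only [len, conj, norm_conj_sub]

/-- Five different points on a circle with four equal chords are obtained by a rotation. -/
lemma exists_rotation {v : Fin 5 → ℂ} (hv : Function.Injective v) {ρ : ℝ}
    (hρ : ∀ k, ‖v k‖ = ρ) (he : IsEquilateral v) :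
    ∃ ω : ℂ, ‖ω‖ = 1 ∧ ω.im ≠ 0 ∧ ∀ k : Fin 5, v k = ω ^ (k : ℕ) * v 0 := by
  have hv0 : ∀ k, v k ≠ 0 := by
    intro k hk
    have : ρ = 0 := by rw [← hρ k, hk, norm_zero]
    have h1 : ∀ k, v k = 0 := fun k => norm_eq_zero.1 ((hρ k).trans this)
    exact absurd (hv ((h1 0).trans (h1 1).symm)) (by decide)
  have hρ0 : 0 < ρ := by rw [← hρ 0]; exact norm_pos_iff.2 (hv0 0)
  -- Two successive quotients have norm one and the same distance to `1`, so they are equal or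
  -- conjugate. In the second case the path would step back to `v a`, against injectivity.
  have step : ∀ a b c : Fin 5, a ≠ c → ‖v b - v a‖ = ‖v c - v b‖ → v c / v b = v b / v a := by
    intro a b c hac h
    have hx : ∀ a b : Fin 5, ‖v b / v a‖ = 1 ∧ ‖v b / v a - 1‖ = ‖v b - v a‖ / ρ := by
      intro a b
      constructor
      · rw [norm_div, hρ, hρ, div_self hρ0.ne']
      · rw [div_sub_one (hv0 a), norm_div, hρ]
    obtain ⟨x1, x2⟩ := hx a b
    obtain ⟨y1, y2⟩ := hx b c
    set x := v b / v a with hxd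
    set y := v c / v b with hyd
    have hxy : ‖x - 1‖ = ‖y - 1‖ := by rw [x2, y2, h]
    have q1 : x.re ^ 2 + x.im ^ 2 = 1 := by rw [← sq_norm_eq, x1]; norm_num
    have q2 : y.re ^ 2 + y.im ^ 2 = 1 := by rw [← sq_norm_eq, y1]; norm_num
    have q3 : (x.re - 1) ^ 2 + x.im ^ 2 = (y.re - 1) ^ 2 + y.im ^ 2 := by
      have := congrArg (· ^ 2) hxy
      simp only [sq_norm_eq] at this
      simpa using this
    have hre : y.re = x.re := by linarith
    have him : y.im ^ 2 = x.im ^ 2 := by rw [hre] at q2; linarith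
    rcases sq_eq_sq_iff_eq_or_eq_neg.1 him with him | him
    · exact Complex.ext hre him
    · exfalso
      have hprod : y * x = 1 := by
        apply Complex.ext
        · simp only [Complex.mul_re, hre, him, Complex.one_re]; linarith
        · simp only [Complex.mul_im, hre, him, Complex.one_im]; ring
      have : y * x = v c / v a := by
        rw [hxd, hyd]; field_simp [hv0 a, hv0 b]
      rw [this, div_eq_one_iff_eq (hv0 a)] at hprod
      exact hac (hv hprod).symm
  obtain ⟨e1, e2, e3⟩ := he
  have s1 := step 0 1 2 (by decide) e1
  have s2 := step 1 2 3 (by decide) e2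
  have s3 := step 2 3 4 (by decide) e3
  set ω := v 1 / v 0 with hω
  have f1 : v 1 = ω * v 0 := by rw [hω, div_mul_cancel₀ _ (hv0 0)]
  have f2 : v 2 = ω * v 1 := by rw [← s1, div_mul_cancel₀ _ (hv0 1)]
  have f3 : v 3 = ω * v 2 := by rw [← s1, ← s2, div_mul_cancel₀ _ (hv0 2)]
  have f4 : v 4 = ω * v 3 := by rw [← s1, ← s2, ← s3, div_mul_cancel₀ _ (hv0 3)]
  have hω1 : ‖ω‖ = 1 := by rw [hω, norm_div, hρ, hρ, div_self hρ0.ne']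
  refine ⟨ω, hω1, ?_, ?_⟩
  · intro him
    have h2 : ω ^ 2 = 1 := by
      have : ω.re ^ 2 = 1 := by
        have := sq_norm_eq ω
        rw [hω1, him] at this; linarith
      apply Complex.ext
      · simp [sq, him]; nlinarith
      · simp [sq, him]
    have : v 2 = v 0 := by rw [f2, f1, ← mul_assoc, ← sq, h2, one_mul]
    exact absurd (hv this) (by decide)
  · intro k
    fin_cases k
    · simp
    · simpa using f1
    · change v 2 = ω ^ 2 * v 0
      rw [f2, f1]; ring
    · change v 3 = ω ^ 3 * v 0
      rw [f3, f2, f1]; ring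
    · change v 4 = ω ^ 4 * v 0
      rw [f4, f3, f2, f1]; ring

/-- The segments `ab` and `cd` have a common point. -/
def Meet (a b c d : ℂ) : Prop :=
  ∃ s ∈ Set.Icc (0 : ℝ) 1, ∃ s' ∈ Set.Icc (0 : ℝ) 1, a + s * (b - a) = c + s' * (d - c)

/-- A path on a circle with equal steps is extremal, unless it crosses itself. -/
lemma isExtremal_of_rotation {u : Fin 5 → ℂ} {c ω v : ℂ} (hω : ‖ω‖ = 1) (him : 0 < ω.im)
    (hu : ∀ k : Fin 5, u k = c + ω ^ (k : ℕ) * v)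
    (h1 : ¬ Meet (u 0) (u 1) (u 3) (u 4)) (h2 : ¬ Meet (u 0) (u 1) (u 2) (u 3)) :
    ∃ t : ℝ, 0 < t ∧ t < 1 ∧ IsExtremal t u := by
  have hn : ω.re ^ 2 + ω.im ^ 2 = 1 := by rw [← sq_norm_eq, hω]; norm_num
  have hre : 0 < 1 + ω.re := by nlinarith
  -- This is the tangent of half the argument of `ω`, so that `ω = zp t / zm t`.
  set t := ω.im / (1 + ω.re) with ht
  have ht0 : 0 < t := div_pos him hre
  have htm : t * (1 + ω.re) = ω.im := div_mul_cancel₀ _ hre.ne'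
  have hωz : ω * zm t = zp t := by
    have e1 : ω.re + t * ω.im = 1 := by
      have : (1 + ω.re) * (ω.re + t * ω.im) = (1 + ω.re) * 1 := by
        linear_combination hn + ω.im * htm
      exact mul_left_cancel₀ hre.ne' this
    apply Complex.ext
    · simp [zm, zp]; linarith
    · simp [zm, zp]; linarith
  have hz := zm_ne_zero t
  have s2 := zp_mul_zm t
  have s3 := zp_sq_add_zm_sq t
  have hω' : ω = zp t / zm t := by rw [eq_div_iff hz, hωz]
  -- If `t ≥ 1`, each step is at least a quarter turn and the path wraps around. For steps shorter
  -- than a third of a turn (`t² < 3`) the last edge meets the first; otherwise the third edge does.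
  -- The path is symmetric under reversal, so the common point is sought on the axis, with
  -- parameters `s` and `1 - s`.
  have ht1 : t < 1 := by
    by_contra! hge
    by_cases h3 : t ^ 2 < 3
    · apply h1
      have hd : 0 < 3 * t ^ 2 - 1 := by nlinarith
      set s := 2 * (t ^ 2 - 1) / (3 * t ^ 2 - 1) with hs
      have hsm : s * (3 * t ^ 2 - 1) = 2 * (t ^ 2 - 1) := div_mul_cancel₀ _ hd.ne'
      have hs0 : 0 ≤ s := div_nonneg (by nlinarith) hd.le
      have hs1 : s ≤ 1 := by rw [hs, div_le_one hd]; nlinarith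
      refine ⟨s, ⟨hs0, hs1⟩, 1 - s, ⟨by linarith, by linarith⟩, ?_⟩
      have hsc : (s : ℂ) * (3 * t ^ 2 - 1) = 2 * (t ^ 2 - 1) := by exact_mod_cast hsm
      have key : (1 - (s : ℂ)) * (1 - ω ^ 4) + s * (ω - ω ^ 3) = 0 := by
        rw [hω']; field_simp
        linear_combination (zm t ^ 2 - zp t ^ 2) * ((1 - s) * s3 + s * s2 + hsc)
      rw [hu 0, hu 1, hu 3, hu 4]
      simp only [Fin.val_zero, Fin.val_one, show ((3 : Fin 5) : ℕ) = 3 from rfl,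
        show ((4 : Fin 5) : ℕ) = 4 from rfl]
      push_cast
      linear_combination v * key
    · apply h2
      have hd : 0 < t ^ 2 - 1 := by linarith
      set s := (t ^ 2 - 3) / (2 * (t ^ 2 - 1)) with hs
      have hsm : s * (2 * (t ^ 2 - 1)) = t ^ 2 - 3 := div_mul_cancel₀ _ (by positivity)
      have hs0 : 0 ≤ s := div_nonneg (by linarith) (by positivity)
      have hs1 : s ≤ 1 := by rw [hs, div_le_one (by positivity)]; nlinarith
      refine ⟨s, ⟨hs0, hs1⟩, 1 - s, ⟨by linarith, by linarith⟩, ?_⟩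
      have hsc : (s : ℂ) * (2 * (t ^ 2 - 1)) = t ^ 2 - 3 := by exact_mod_cast hsm
      have key : (1 - (s : ℂ)) * (1 - ω ^ 3) + s * (ω - ω ^ 2) = 0 := by
        rw [hω']; field_simp
        linear_combination (zm t - zp t) * ((1 - s) * (s3 + s2) + s * s2 + hsc)
      rw [hu 0, hu 1, hu 2, hu 3]
      simp only [Fin.val_zero, Fin.val_one, show ((3 : Fin 5) : ℕ) = 3 from rfl, Fin.val_two]
      push_cast
      linear_combination v * key
  refine ⟨t, ht0, ht1, fun k => ?_⟩
  have h1 : 1 - t ^ 2 ≠ 0 := by nlinarith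
  have := extremal_mul h1 hωz k
  rw [hu k, hu 0, hu 4]
  simp only [Fin.val_zero, show ((4 : Fin 5) : ℕ) = 4 from rfl]
  linear_combination v * this

lemma Meet.of_conj {a b c d : ℂ} (h : Meet ((starRingEnd ℂ) a) ((starRingEnd ℂ) b)
    ((starRingEnd ℂ) c) ((starRingEnd ℂ) d)) : Meet a b c d := by
  obtain ⟨s, hs, s', hs', h⟩ := h
  refine ⟨s, hs, s', hs', ?_⟩
  have := congrArg (starRingEnd ℂ) h
  simpa using this

/-- A path without self-crossings on a circle with equal steps is extremal up to reflection. -/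
theorem isExtremal_or_conj {u : Fin 5 → ℂ} (hu : Function.Injective u) {c : ℂ} {ρ : ℝ}
    (hρ : ∀ k, ‖u k - c‖ = ρ) (he : IsEquilateral u)
    (h1 : ¬ Meet (u 0) (u 1) (u 3) (u 4)) (h2 : ¬ Meet (u 0) (u 1) (u 2) (u 3)) :
    ∃ t : ℝ, 0 < t ∧ t < 1 ∧ (IsExtremal t u ∨ IsExtremal t (conj u)) := by
  obtain ⟨ω, hω, him, hk⟩ := exists_rotation (v := fun k => u k - c)
    (fun a b h => hu (sub_left_injective h)) hρ (by simpa [IsEquilateral] using he)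
  rcases lt_or_gt_of_ne him with him | him
  · obtain ⟨t, ht0, ht1, h⟩ := isExtremal_of_rotation (u := conj u) (c := (starRingEnd ℂ) c)
      (ω := (starRingEnd ℂ) ω) (v := (starRingEnd ℂ) (u 0 - c)) (by rwa [RCLike.norm_conj])
      (by simpa using him)
      (fun k => by
        rw [conj, ← map_pow, ← map_mul, ← map_add, ← hk k]; congr 1; ring)
      (fun h => h1 h.of_conj) (fun h => h2 h.of_conj)
    exact ⟨t, ht0, ht1, Or.inr h⟩
  · obtain ⟨t, ht0, ht1, h⟩ := isExtremal_of_rotation (u := u) hω him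
      (fun k => by rw [← hk k]; ring) h1 h2
    exact ⟨t, ht0, ht1, Or.inl h⟩

end Arc

/-! ### From the plane to complex numbers -/

namespace Plane

/-- The plane as the complex numbers. -/
def toC (x : Plane) : ℂ := ⟨x 0, x 1⟩

lemma norm_toC_sub (x y : Plane) : ‖toC x - toC y‖ = dist x y := by
  rw [EuclideanSpace.dist_eq, eq_comm, Real.sqrt_eq_iff_mul_self_eq (by positivity) (norm_nonneg _),
    ← sq, Arc.sq_norm_eq]
  simp [toC, Fin.sum_univ_two, Real.dist_eq, sq_abs]

lemma toC_injective : Function.Injective toC := fun _ _ h =>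
  ext_coord (congrArg Complex.re h) (congrArg Complex.im h)

/-- The complex numbers as the plane. -/
def ofC (z : ℂ) : Plane := !₂[z.re, z.im]

lemma toC_ofC (z : ℂ) : toC (ofC z) = z := by
  apply Complex.ext <;> simp [toC, ofC]

end Plane

/-! ### Convex polygons, and pentagons as a chord with a path -/

namespace Polygon

open Plane

section Convex

variable {n : ℕ} {p : Polygon Plane n}

/-- A polygon for which all vertices off an edge lie strictly to the left of it is simple. -/
lemma isSimple_of_cross_pos (hn : 3 ≤ n)
    (h : ∀ i j, j ≠ i → j ≠ finRotate n i → 0 < cross (p i) (p (finRotate n i)) (p j)) :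
    p.IsSimple := by
  have hself : ∀ a b : Plane, cross a b a = 0 := fun a b => by simp [cross]
  have hself' : ∀ a b : Plane, cross a b b = 0 := fun a b => by simp only [cross]; ring
  have hsame : ∀ a b : Plane, cross a a b = 0 := fun a b => by simp [cross]
  have hinj : Function.Injective p.vertices := by
    intro a b hab
    by_contra hne
    by_cases hb : b = finRotate n a
    · have := h a (finRotate n (finRotate n a)) (finRotate_ne hn a).2 (finRotate_ne hn _).1
      rw [← hb, ← hab, hsame] at this
      exact this.false
    · have := h a b (Ne.symm hne) hb
      rw [← hab, hself] at this
      exact this.false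
  have hnonneg : ∀ i j, 0 ≤ cross (p i) (p (finRotate n i)) (p j) := by
    intro i j
    by_cases h1 : j = i
    · rw [h1, hself]
    by_cases h2 : j = finRotate n i
    · rw [h2, hself']
    exact (h i j h1 h2).le
  have hzero : ∀ i j, cross (p i) (p (finRotate n i)) (p j) = 0 → j = i ∨ j = finRotate n i := by
    intro i j h0
    by_contra! hcon
    exact (h i j hcon.1 hcon.2).ne' h0
  have key : ∀ i j, i ≠ j → ∀ x ∈ p.edgeSet ℝ i ∩ p.edgeSet ℝ j,
      x = p i ∨ x = p (finRotate n i) := by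
    rintro i j hij x ⟨hx, hx'⟩
    have hx0 := cross_eq_zero_of_mem hx
    obtain ⟨s, hs, e0, e1⟩ := mem_affineSegment_iff.1 hx'
    have hc : cross (p i) (p (finRotate n i)) x =
        (1 - s) * cross (p i) (p (finRotate n i)) (p j) +
          s * cross (p i) (p (finRotate n i)) (p (finRotate n j)) := by
      simp only [cross, e0, e1]; ring
    rw [hx0] at hc
    have a1 := mul_nonneg (sub_nonneg.2 hs.2) (hnonneg i j)
    have a2 := mul_nonneg hs.1 (hnonneg i (finRotate n j))
    have b1 : (1 - s) * cross (p i) (p (finRotate n i)) (p j) = 0 := by linarith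
    have b2 : s * cross (p i) (p (finRotate n i)) (p (finRotate n j)) = 0 := by linarith
    rcases mul_eq_zero.1 b1 with hs1 | hj
    · have hxj : x = p (finRotate n j) := by
        obtain rfl : s = 1 := by linarith
        exact ext_coord (by rw [e0]; ring) (by rw [e1]; ring)
      rcases hzero _ _ ((mul_eq_zero.1 b2).resolve_left (by linarith)) with h' | h'
      · left; rw [hxj, h']
      · right; rw [hxj, h']
    · rcases mul_eq_zero.1 b2 with hs0 | hj'
      · have hxj : x = p j := ext_coord (by rw [e0, hs0]; ring) (by rw [e1, hs0]; ring)
        rcases hzero _ _ hj with h' | h'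
        · left; rw [hxj, h']
        · right; rw [hxj, h']
      · exfalso
        rcases hzero _ _ hj with h1 | h1
        · exact hij h1.symm
        · rcases hzero _ _ hj' with h2 | h2
          · rw [h1] at h2; exact (finRotate_ne hn i).2 h2
          · exact hij ((finRotate n).injective h2).symm
  exact ⟨hinj, fun i j hij x hx => ⟨key i j hij x hx, key j i hij.symm x hx.symm⟩⟩

end Convex

variable {p : Polygon Plane 5}

/-- The vertices of a pentagon, listed from the end of the `i`-th edge to its beginning. -/
def arc (p : Polygon Plane 5) (i : Fin 5) : Fin 5 → ℂ := fun k => toC (p (i + 1 + k))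

lemma edgeLength_eq (p : Polygon Plane 5) (i : Fin 5) :
    p.edgeLength i = dist (p i) (p (i + 1)) := by
  rw [edgeLength, finRotate_apply]

lemma norm_arc_sub (p : Polygon Plane 5) (i a b : Fin 5) :
    ‖p.arc i a - p.arc i b‖ = dist (p (i + 1 + a)) (p (i + 1 + b)) := norm_toC_sub _ _

lemma norm_arc_chord (p : Polygon Plane 5) (i : Fin 5) :
    ‖p.arc i 4 - p.arc i 0‖ = p.edgeLength i := by
  rw [norm_arc_sub, edgeLength_eq]
  congr 2 <;> decide +revert

lemma norm_arc_succ_sub (p : Polygon Plane 5) (i m : Fin 5) :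
    ‖p.arc i (m + 1) - p.arc i m‖ = p.edgeLength (i + 1 + m) := by
  rw [norm_arc_sub, edgeLength_eq, dist_comm, add_assoc (i + 1)]

lemma len_arc (p : Polygon Plane 5) (i : Fin 5) :
    Arc.len (p.arc i) = p.perimeter - p.edgeLength i := by
  have h0 := norm_arc_succ_sub p i 0
  have h1 := norm_arc_succ_sub p i 1
  have h2 := norm_arc_succ_sub p i 2
  have h3 := norm_arc_succ_sub p i 3
  simp only [zero_add, Fin.reduceAdd] at h0 h1 h2 h3
  rw [Arc.len, h0, h1, h2, h3, perimeter, ← Equiv.sum_comp (Equiv.addLeft (i + 1)),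
    Fin.sum_univ_five]
  simp only [Equiv.coe_addLeft]
  rw [show i + 1 + 4 = i by clear * -; decide +revert]
  ring

lemma area_arc (p : Polygon Plane 5) (i : Fin 5) : Arc.area (p.arc i) = p.shoelace := by
  rw [shoelace, ← Equiv.sum_comp (Equiv.addLeft (i + 1)), Fin.sum_univ_five]
  simp only [Equiv.coe_addLeft, finRotate_apply, add_assoc (i + 1), Fin.reduceAdd, zero_add,
    Arc.area, arc, crossC, toC]
  ring

lemma edgeLength_le_len (p : Polygon Plane 5) (i : Fin 5) :
    p.edgeLength i ≤ p.perimeter - p.edgeLength i := by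
  rw [← len_arc, ← norm_arc_chord, Arc.len]
  have := norm_add₄_le (a := p.arc i 1 - p.arc i 0) (b := p.arc i 2 - p.arc i 1)
    (c := p.arc i 3 - p.arc i 2) (d := p.arc i 4 - p.arc i 3)
  have e : p.arc i 4 - p.arc i 0 = (p.arc i 1 - p.arc i 0) + (p.arc i 2 - p.arc i 1) +
      (p.arc i 3 - p.arc i 2) + (p.arc i 4 - p.arc i 3) := by ring
  rwa [e]

lemma _root_.IsUnitPentagon.abs_shoelace (h : IsUnitPentagon p) : |p.shoelace| = 1 := by
  have h1 := h.2
  rw [h.1.area_eq (by norm_num)] at h1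
  rwa [ENNReal.ofReal_eq_one] at h1

lemma isUnitPentagon_of_shoelace (h : p.IsSimple) (h' : p.shoelace = 1) : IsUnitPentagon p :=
  ⟨h, by rw [h.area_eq (by norm_num), h', abs_one, ENNReal.ofReal_one]⟩

lemma _root_.IsUnitPentagon.edgeLength_pos (h : IsUnitPentagon p) (i : Fin 5) :
    0 < p.edgeLength i := dist_pos.2 (h.1.vertex_ne (by norm_num) i)

/-- The isoperimetric inequality for unit-area pentagons with a given edge. -/
theorem _root_.IsUnitPentagon.perimeter_bound (h : IsUnitPentagon p) (i : Fin 5) {t : ℝ}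
    (ht0 : 0 < t) (ht1 : t < 1) :
    16 * t + 4 * Arc.chordCoeff t * p.edgeLength i ^ 2 ≤ (p.perimeter - p.edgeLength i) ^ 2 := by
  have hchord := norm_arc_chord p i
  rw [← len_arc p i]
  rcases eq_or_eq_neg_of_abs_eq h.abs_shoelace with hs | hs
  · have := Arc.len_sq_ge ht0 ht1 (p.arc i)
    rwa [area_arc, hs, hchord, mul_one] at this
  · have := Arc.len_sq_ge ht0 ht1 (Arc.conj (p.arc i))
    rwa [Arc.area_conj, Arc.len_conj, area_arc, hs, Arc.conj, Arc.conj, Arc.norm_conj_sub, hchord,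
      neg_neg, mul_one] at this

/-- The path complementary to the `i`-th edge is extremal with parameter `t`, up to reflection. -/
def IsExtremalAt (p : Polygon Plane 5) (i : Fin 5) (t : ℝ) : Prop :=
  Arc.IsExtremal t (p.arc i) ∨ Arc.IsExtremal t (Arc.conj (p.arc i))

lemma _root_.IsUnitPentagon.isExtremalAt (h : IsUnitPentagon p) {i : Fin 5} {t : ℝ}
    (ht0 : 0 < t) (ht1 : t < 1) (hle : (p.perimeter - p.edgeLength i) ^ 2 ≤
      16 * t + 4 * Arc.chordCoeff t * p.edgeLength i ^ 2) : p.IsExtremalAt i t := by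
  have hchord := norm_arc_chord p i
  rw [← len_arc p i] at hle
  rcases eq_or_eq_neg_of_abs_eq h.abs_shoelace with hs | hs
  · refine Or.inl (Arc.eq_extremal_of_len_sq_le ht0 ht1 ?_)
    rwa [area_arc, hs, hchord, mul_one]
  · refine Or.inr (Arc.eq_extremal_of_len_sq_le ht0 ht1 ?_)
    rwa [Arc.area_conj, Arc.len_conj, area_arc, hs, Arc.conj, Arc.conj, Arc.norm_conj_sub, hchord,
      neg_neg, mul_one]

/-- The general bound gives one inequality. For the other, the path or its mirror image attains
equality with its own signed area, which is at most `1`; the orientation need not be known. -/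
lemma IsExtremalAt.len_sq (h : IsUnitPentagon p) {i : Fin 5} {t : ℝ}
    (ht0 : 0 < t) (ht1 : t < 1) (he : p.IsExtremalAt i t) :
    (p.perimeter - p.edgeLength i) ^ 2 = 16 * t + 4 * Arc.chordCoeff t * p.edgeLength i ^ 2 := by
  have hb := h.perimeter_bound i ht0 ht1
  refine le_antisymm ?_ hb
  have hs := abs_le.1 h.abs_shoelace.le
  rw [← len_arc, ← norm_arc_chord]
  rcases he with he | he
  · rw [he.len_sq ht0 ht1, area_arc]
    nlinarith
  · have := he.len_sq ht0 ht1
    rw [Arc.area_conj, Arc.len_conj, area_arc, Arc.conj, Arc.conj, Arc.norm_conj_sub] at this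
    nlinarith

/-- The bound depends only on `t` and the length of the chosen edge, so every competitor obeys the
bound that the extremal pentagon attains. -/
lemma IsExtremalAt.isPerimeterMinimizer (h : IsUnitPentagon p) {i : Fin 5} {t : ℝ}
    (ht0 : 0 < t) (ht1 : t < 1) (he : p.IsExtremalAt i t) :
    IsPerimeterMinimizer (p.edgeLength i) p := by
  refine ⟨⟨h, i, rfl⟩, fun q hq ⟨j, hj⟩ => ?_⟩
  have h1 := hq.perimeter_bound j ht0 ht1
  rw [hj, ← IsExtremalAt.len_sq h ht0 ht1 he] at h1
  have h2 := edgeLength_le_len q j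
  have h3 := hq.edgeLength_pos j
  have := abs_le_of_sq_le_sq' h1 (by linarith)
  linarith [this.2]

/-- The convex pentagon inscribed in a circle that is bounded by an extremal path and its chord. -/
def extremalPentagon (e t : ℝ) : Polygon Plane 5 := ⟨fun k => ofC (e * Arc.extremal t k)⟩

lemma arc_extremalPentagon (e t : ℝ) :
    (extremalPentagon e t).arc 4 = fun k => e * Arc.extremal t k := by
  funext k
  simp only [arc, extremalPentagon, toC_ofC]
  rw [show (4 : Fin 5) + 1 + k = k by clear * -; decide +revert]

lemma isExtremalAt_extremalPentagon (e t : ℝ) : (extremalPentagon e t).IsExtremalAt 4 t := by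
  refine Or.inl fun k => ?_
  simp only [arc_extremalPentagon, Arc.extremal_zero, Arc.extremal_four]; ring

lemma edgeLength_extremalPentagon {e : ℝ} (he : 0 < e) (t : ℝ) :
    (extremalPentagon e t).edgeLength 4 = e := by
  rw [← norm_arc_chord, arc_extremalPentagon]
  simp [Arc.extremal_zero, Arc.extremal_four, abs_of_pos he]

lemma shoelace_extremalPentagon (e t : ℝ) :
    (extremalPentagon e t).shoelace = e ^ 2 * Arc.area (Arc.extremal t) := by
  rw [← area_arc _ 4, arc_extremalPentagon]
  simp only [Arc.area, crossC, Complex.mul_re, Complex.mul_im, Complex.ofReal_re,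
    Complex.ofReal_im]
  ring

/-- A common positive factor is split off so that convexity becomes a matter of polynomials in `t`.
-/
lemma extremalPentagon_coord {e t : ℝ} (h : 1 - t ^ 2 ≠ 0) (k : Fin 5) :
    extremalPentagon e t k 0 = e / (4 * (1 - t ^ 2)) *
      ![0, 1 - 3 * t ^ 2, 2 * (1 - t ^ 2), 3 - t ^ 2, 4 * (1 - t ^ 2)] k ∧
    extremalPentagon e t k 1 = e / (4 * (1 - t ^ 2)) *
      ![0, -(3 * t - t ^ 3), -4 * t, -(3 - t ^ 2) * t, 0] k := by
  have hmul : ∀ a b c d : ℝ, d ≠ 0 → ∀ z : ℂ, z * (d : ℂ) = a + b * Complex.I →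
      ((c * z : ℂ).re = c / d * a ∧ (c * z : ℂ).im = c / d * b) := by
    intro a b c d hd z hz
    have h1 := congrArg Complex.re hz
    have h2 := congrArg Complex.im hz
    simp at h1 h2
    simp
    constructor
    · rw [← h1]; field_simp
    · rw [← h2]; field_simp
  have hc := Arc.cast_one_sub_sq_ne h
  have h4 : 4 * (1 - t ^ 2) ≠ 0 := mul_ne_zero four_ne_zero h
  have hI := Complex.I_sq
  simp only [extremalPentagon, ofC, PiLp.toLp_apply, Matrix.cons_val_zero, Matrix.cons_val_one]
  refine hmul _ _ e _ h4 _ ?_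
  fin_cases k
  · simp [Arc.extremal_zero]
  · simp only [Fin.mk_one, Arc.extremal_one, Arc.zm, Matrix.cons_val_one, Matrix.cons_val_zero]
    push_cast; field_simp
    linear_combination (3 * (t : ℂ) ^ 2 - (t : ℂ) ^ 3 * Complex.I) * hI
  · simp only [Fin.reduceFinMk, Arc.extremal_two, Arc.zm, Matrix.cons_val]
    push_cast; field_simp
    linear_combination (4 * (t : ℂ) ^ 2) * hI
  · simp only [Fin.reduceFinMk, Arc.extremal_three, Arc.zm, Matrix.cons_val]
    push_cast; field_simp
    ring
  · simp only [Fin.reduceFinMk, Arc.extremal_four, Matrix.cons_val]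
    push_cast; ring

lemma isSimple_extremalPentagon {e t : ℝ} (he : 0 < e) (ht0 : 0 < t) (ht1 : t < 1) :
    (extremalPentagon e t).IsSimple := by
  have h1 : 0 < 1 - t ^ 2 := by nlinarith
  have h3 : 0 < 3 - t ^ 2 := by linarith
  -- Up to the square of the common factor, these are the only values of `cross` for an edge and a
  -- vertex off it.
  have f1 : 0 < 2 * t * (1 + t ^ 2) ^ 2 := by positivity
  have f2 : 0 < 2 * t * (3 - t ^ 2) * (1 + t ^ 2) := by positivity
  have f3 : 0 < 4 * t * (3 - t ^ 2) * (1 - t ^ 2) := by positivity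
  have f4 : 0 < 16 * t * (1 - t ^ 2) := by positivity
  refine isSimple_of_cross_pos (by norm_num) fun i j hji hj => ?_
  rw [finRotate_apply] at hj ⊢
  simp only [cross, fun k => (extremalPentagon_coord h1.ne' (e := e) k).1,
    fun k => (extremalPentagon_coord h1.ne' (e := e) k).2]
  have hκ : 0 < e / (4 * (1 - t ^ 2)) := by positivity
  set κ := e / (4 * (1 - t ^ 2))
  have key : ∀ a b c d : ℝ, 0 < a * b - c * d →
      0 < (κ * a) * (κ * b) - (κ * c) * (κ * d) := by
    intro a b c d h
    have := mul_pos (mul_pos hκ hκ) h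
    linarith
  simp only [← mul_sub]
  apply key
  fin_cases i <;> fin_cases j <;> first | exact absurd rfl hji | exact absurd rfl hj | skip
  all_goals
    simp only [Fin.zero_eta, Fin.mk_one, Fin.reduceFinMk, Fin.reduceAdd, zero_add,
      Matrix.cons_val, Matrix.cons_val_zero, Matrix.cons_val_one]
    linarith

lemma IsExtremalAt.exists_center {i : Fin 5} {t : ℝ} (ht0 : 0 < t) (ht1 : t < 1)
    (h : p.IsExtremalAt i t) : ∃ (c : ℂ) (r : ℝ), ∀ k, ‖p.arc i k - c‖ = r := by
  have h1 : 1 - t ^ 2 ≠ 0 := by nlinarith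
  obtain ⟨c, hc⟩ := Arc.exists_center ht0 h1
  have key : ∀ u : Fin 5 → ℂ, Arc.IsExtremal t u →
      ∃ (c : ℂ) (r : ℝ), ∀ k, ‖u k - c‖ = r := by
    intro u hu
    refine ⟨u 0 + (u 4 - u 0) * c, ‖u 4 - u 0‖ * ‖c‖, fun k => ?_⟩
    rw [← hc k, ← norm_mul]
    congr 1
    linear_combination hu k
  rcases h with h | h
  · exact key _ h
  · obtain ⟨c, r, hcr⟩ := key _ h
    refine ⟨(starRingEnd ℂ) c, r, fun k => ?_⟩
    rw [← hcr k, Arc.conj, ← Arc.norm_conj_sub (p.arc i k), Complex.conj_conj]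

lemma isEquilateral_conj {u : Fin 5 → ℂ} :
    Arc.IsEquilateral (Arc.conj u) ↔ Arc.IsEquilateral u := by
  simp only [Arc.IsEquilateral, Arc.conj, Arc.norm_conj_sub]

lemma isEquilateral_arc_iff (p : Polygon Plane 5) (i : Fin 5) :
    Arc.IsEquilateral (p.arc i) ↔
      ∀ j k : Fin 5, j ≠ i → k ≠ i → p.edgeLength j = p.edgeLength k := by
  have h0 := norm_arc_succ_sub p i 0
  have h1 := norm_arc_succ_sub p i 1
  have h2 := norm_arc_succ_sub p i 2
  have h3 := norm_arc_succ_sub p i 3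
  simp only [zero_add, Fin.reduceAdd] at h0 h1 h2 h3
  rw [Arc.IsEquilateral, h0, h1, h2, h3]
  constructor
  · rintro ⟨e1, e2, e3⟩
    have key : ∀ j, j ≠ i → p.edgeLength j = p.edgeLength (i + 1 + 0) := by
      intro j hj
      have hcases : j = i + 1 + 0 ∨ j = i + 1 + 1 ∨ j = i + 1 + 2 ∨ j = i + 1 + 3 := by
        clear * - hj; decide +revert
      rcases hcases with rfl | rfl | rfl | rfl
      · rfl
      · exact e1.symm
      · rw [e1, e2]
      · rw [e1, e2, e3]
    intro j k hj hk
    rw [key j hj, key k hk]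
  · intro h
    exact ⟨h _ _ (by clear * -; decide +revert) (by clear * -; decide +revert),
      h _ _ (by clear * -; decide +revert) (by clear * -; decide +revert),
      h _ _ (by clear * -; decide +revert) (by clear * -; decide +revert)⟩

lemma IsExtremalAt.cospherical {i : Fin 5} {t : ℝ} (ht0 : 0 < t) (ht1 : t < 1)
    (h : p.IsExtremalAt i t) : EuclideanGeometry.Cospherical (Set.range p.vertices) := by
  obtain ⟨c, r, hc⟩ := h.exists_center ht0 ht1
  refine ⟨ofC c, r, ?_⟩
  rintro _ ⟨j, rfl⟩
  have := hc (j - (i + 1))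
  rwa [arc, add_sub_cancel, ← toC_ofC c, norm_toC_sub] at this

lemma IsExtremalAt.edgeLength_eq {i : Fin 5} {t : ℝ} (ht0 : 0 < t) (ht1 : t < 1)
    (h : p.IsExtremalAt i t) :
    ∀ j k : Fin 5, j ≠ i → k ≠ i → p.edgeLength j = p.edgeLength k := by
  have h1 : 1 - t ^ 2 ≠ 0 := by nlinarith
  rw [← isEquilateral_arc_iff]
  rcases h with h | h
  · exact h.isEquilateral h1
  · exact isEquilateral_conj.1 (h.isEquilateral h1)

/-- All distances depend on the edge length and `t` alone; this yields uniqueness up to congruence.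
-/
lemma IsExtremalAt.dist_eq {i : Fin 5} {t : ℝ} (h : p.IsExtremalAt i t) (a b : Fin 5) :
    dist (p (i + 1 + a)) (p (i + 1 + b)) =
      p.edgeLength i * ‖Arc.extremal t a - Arc.extremal t b‖ := by
  rw [← norm_arc_sub, ← norm_arc_chord]
  rcases h with h | h
  · rw [h.sub a b, norm_mul]
  · rw [← Arc.norm_conj_sub, ← Arc.norm_conj_sub (p.arc i 4)]
    have := h.sub a b
    simp only [Arc.conj] at this
    rw [this, norm_mul]

lemma IsSimple.not_meet (hp : p.IsSimple) {a b : Fin 5} (h1 : a ≠ b) (h2 : a ≠ b + 1)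
    (h3 : a + 1 ≠ b) : ¬ Arc.Meet (toC (p a)) (toC (p (a + 1))) (toC (p b)) (toC (p (b + 1))) := by
  rintro ⟨s, hs, s', hs', h⟩
  have hre := congrArg Complex.re h
  have him := congrArg Complex.im h
  simp [toC] at hre him
  set x : Plane := !₂[p a 0 + s * (p (a + 1) 0 - p a 0), p a 1 + s * (p (a + 1) 1 - p a 1)] with hx
  have hxa : x ∈ p.edgeSet ℝ a := by
    rw [edgeSet, finRotate_apply]
    exact mem_affineSegment_iff.2 ⟨s, hs, by simp [hx], by simp [hx]⟩
  have hxb : x ∈ p.edgeSet ℝ b := by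
    rw [edgeSet, finRotate_apply]
    exact mem_affineSegment_iff.2 ⟨s', hs', by simpa [hx] using hre, by simpa [hx] using him⟩
  have := hp.2 a b h1 ⟨hxa, hxb⟩
  rw [finRotate_apply, finRotate_apply] at this
  rcases this with ⟨e | e, e' | e'⟩
  · exact h1 (hp.1 (e.symm.trans e'))
  · exact h2 (hp.1 (e.symm.trans e'))
  · exact h3 (hp.1 (e.symm.trans e'))
  · exact h1 (add_right_cancel (hp.1 (e.symm.trans e')))

/-- A simple pentagon inscribed in a circle, four edges of which are equal, is extremal. -/
lemma IsSimple.exists_isExtremalAt (hp : p.IsSimple) {i : Fin 5}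
    (hc : EuclideanGeometry.Cospherical (Set.range p.vertices))
    (he : ∀ j k : Fin 5, j ≠ i → k ≠ i → p.edgeLength j = p.edgeLength k) :
    ∃ t, 0 < t ∧ t < 1 ∧ p.IsExtremalAt i t := by
  obtain ⟨c, r, hcr⟩ := hc
  refine Arc.isExtremal_or_conj (u := p.arc i) (c := toC c) (ρ := r) ?_ ?_
    ((isEquilateral_arc_iff p i).2 he) ?_ ?_
  · intro a b hab
    exact add_left_cancel (hp.1 (toC_injective hab))
  · intro k
    rw [arc, norm_toC_sub]
    exact hcr _ ⟨_, rfl⟩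
  · have := hp.not_meet (a := i + 1 + 0) (b := i + 1 + 3) (by clear * -; decide +revert)
      (by clear * -; decide +revert) (by clear * -; decide +revert)
    simp only [add_assoc (i + 1), Fin.reduceAdd, zero_add] at this
    exact this
  · have := hp.not_meet (a := i + 1 + 0) (b := i + 1 + 2) (by clear * -; decide +revert)
      (by clear * -; decide +revert) (by clear * -; decide +revert)
    simp only [add_assoc (i + 1), Fin.reduceAdd, zero_add] at this
    exact this

/-- For given `e` there is a parameter `t` that describes all minimizers. -/
lemma exists_minimizer {e : ℝ} (he : 0 < e) :
    (∃ p : Polygon Plane 5, IsPerimeterMinimizer e p) ∧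
    ∃ t, 0 < t ∧ t < 1 ∧ ∀ (p : Polygon Plane 5) (i : Fin 5), IsPerimeterMinimizer e p →
      p.edgeLength i = e → p.IsExtremalAt i t := by
  obtain ⟨t, ht0, ht1, ht⟩ := Arc.exists_parameter he
  set q := extremalPentagon e t
  have hq : IsUnitPentagon q := isUnitPentagon_of_shoelace (isSimple_extremalPentagon he ht0 ht1)
    (by rw [shoelace_extremalPentagon, ht])
  have hqe := edgeLength_extremalPentagon he t
  have hqx := isExtremalAt_extremalPentagon e t
  refine ⟨⟨q, ?_⟩, t, ht0, ht1, fun p i hp hi => ?_⟩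
  · have := hqx.isPerimeterMinimizer hq ht0 ht1
    rwa [hqe] at this
  -- A minimizer is no longer than `q`, so it too attains the bound with the parameter of `q`.
  · refine hp.1.1.isExtremalAt ht0 ht1 ?_
    have h1 := hqx.len_sq hq ht0 ht1
    have h2 := hp.2 q hq ⟨4, hqe⟩
    rw [hqe] at h1
    rw [hi, ← h1]
    have h3 := edgeLength_le_len p i
    rw [hi] at h3
    exact pow_le_pow_left₀ (by linarith) (by linarith) 2

/-! ### Numerical bounds for edge lengths -/

lemma two_mul_sqrt_lt : 2 * √(2 + √3) < 3.8637035 := by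
  have h3 : √3 < 1.7320509 := by
    rw [Real.sqrt_lt' (by norm_num)]; norm_num
  have : √(2 + √3) < 1.93185175 := by
    rw [Real.sqrt_lt' (by norm_num)]
    have : (1.93185175 : ℝ) ^ 2 > 2 + 1.7320509 := by norm_num
    linarith
  linarith

/-- For each fixed `t` this is a quadratic inequality in the edge length. The bound `edge ≤
perimeter - edge` keeps the squared base nonnegative, so the perimeter may be replaced by `P`. -/
lemma _root_.IsUnitPentagon.quadratic_bound (h : IsUnitPentagon p) (i : Fin 5) {P t : ℝ}
    (hP : p.perimeter ≤ P) (ht0 : 0 < t) (ht1 : t < 1) :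
    16 * t + 4 * Arc.chordCoeff t * p.edgeLength i ^ 2 ≤ (P - p.edgeLength i) ^ 2 := by
  refine (h.perimeter_bound i ht0 ht1).trans (pow_le_pow_left₀ ?_ (by linarith) 2)
  linarith [edgeLength_le_len p i, h.edgeLength_pos i]

lemma _root_.IsEfficientPentagon.edgeLength_mem (h : IsEfficientPentagon p) (i : Fin 5) :
    0.3928 < p.edgeLength i ∧ p.edgeLength i < 1.092 := by
  have hP : p.perimeter ≤ 3.8637035 := h.2.trans two_mul_sqrt_lt.le
  have h0 := h.1.edgeLength_pos i
  have hle := edgeLength_le_len p i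
  -- The values `0.8604` and `0.6074` are close to the extremal parameters for the edge lengths
  -- `0.3928` and `1.092`, where the bound is sharpest; `0.935` and `0.41` serve very short and very
  -- long edges. For each `t` the difference of the two sides is convex in `x`, so its negativity at
  -- both ends of an interval excludes the interval. The products passed to `nlinarith` express
  -- this.
  have q1 := h.1.quadratic_bound i hP (t := 0.935) (by norm_num) (by norm_num)
  have q2 := h.1.quadratic_bound i hP (t := 0.8604) (by norm_num) (by norm_num)
  have q3 := h.1.quadratic_bound i hP (t := 0.6074) (by norm_num) (by norm_num)
  have q4 := h.1.quadratic_bound i hP (t := 0.41) (by norm_num) (by norm_num)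
  set x := p.edgeLength i
  norm_num [Arc.chordCoeff] at q1 q2 q3 q4
  constructor
  · by_contra! hx
    rcases le_total x 0.25 with hx' | hx'
    · nlinarith [mul_nonneg h0.le (sub_nonneg.2 hx')]
    · nlinarith [mul_nonneg (sub_nonneg.2 hx') (sub_nonneg.2 hx)]
  · by_contra! hx
    rcases le_total x 1.7 with hx' | hx'
    · nlinarith [mul_nonneg (sub_nonneg.2 hx) (sub_nonneg.2 hx')]
    · have hx2 : x ≤ 1.94 := by linarith
      nlinarith [mul_nonneg (sub_nonneg.2 hx') (sub_nonneg.2 hx2)]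

lemma _root_.IsUnitPentagon.edgeLength_mem (h : IsUnitPentagon p) (hP : p.perimeter ≤ 3.86)
    (i : Fin 5) : 0.4073 < p.edgeLength i ∧ p.edgeLength i < 1.081 := by
  have h0 := h.edgeLength_pos i
  have hle := edgeLength_le_len p i
  -- As before, `0.8551` and `0.6113` are close to the extremal parameters for the edge lengths
  -- `0.4073` and `1.081`.
  have q1 := h.quadratic_bound i hP (t := 0.935) (by norm_num) (by norm_num)
  have q2 := h.quadratic_bound i hP (t := 0.8551) (by norm_num) (by norm_num)
  have q3 := h.quadratic_bound i hP (t := 0.6113) (by norm_num) (by norm_num)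
  have q4 := h.quadratic_bound i hP (t := 0.41) (by norm_num) (by norm_num)
  set x := p.edgeLength i
  norm_num [Arc.chordCoeff] at q1 q2 q3 q4
  constructor
  · by_contra! hx
    rcases le_total x 0.27 with hx' | hx'
    · nlinarith [mul_nonneg h0.le (sub_nonneg.2 hx')]
    · nlinarith [mul_nonneg (sub_nonneg.2 hx') (sub_nonneg.2 hx)]
  · by_contra! hx
    rcases le_total x 1.7 with hx' | hx'
    · nlinarith [mul_nonneg (sub_nonneg.2 hx) (sub_nonneg.2 hx')]
    · have hx2 : x ≤ 1.94 := by linarith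
      nlinarith [mul_nonneg (sub_nonneg.2 hx') (sub_nonneg.2 hx2)]

end Polygon
end

open Polygon in
theorem proposition2p11 :
    (∀ e : ℝ, 0 < e →
      (∃ p : Polygon Plane 5, IsPerimeterMinimizer e p) ∧
      (∀ (p : Polygon Plane 5) (i : Fin 5), IsUnitPentagon p → p.edgeLength i = e →
        (IsPerimeterMinimizer e p ↔
          EuclideanGeometry.Cospherical (Set.range p.vertices) ∧
            ∀ j k : Fin 5, j ≠ i → k ≠ i → p.edgeLength j = p.edgeLength k)) ∧
      (∀ (p q : Polygon Plane 5) (i j : Fin 5),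
        IsPerimeterMinimizer e p → p.edgeLength i = e →
        IsPerimeterMinimizer e q → q.edgeLength j = e →
          Congruent (fun k : Fin 5 => p (i + k)) (fun k : Fin 5 => q (j + k)))) ∧
    (∀ p : Polygon Plane 5, IsEfficientPentagon p →
      ∀ i : Fin 5, 0.3928 < p.edgeLength i ∧ p.edgeLength i < 1.092) ∧
    (∀ p : Polygon Plane 5, IsUnitPentagon p → p.perimeter ≤ 3.86 →
      ∀ i : Fin 5, 0.4073 < p.edgeLength i ∧ p.edgeLength i < 1.081) := by
  refine ⟨fun e he => ?_, fun p hp i => hp.edgeLength_mem i, fun p hp hP i =>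
    hp.edgeLength_mem hP i⟩
  obtain ⟨hex, t, ht0, ht1, hmin⟩ := exists_minimizer he
  refine ⟨hex, fun p i hp hi => ⟨fun h => ?_, fun h => ?_⟩, fun p q i j hp hi hq hj => ?_⟩
  · have hx := hmin p i h hi
    exact ⟨hx.cospherical ht0 ht1, hx.edgeLength_eq ht0 ht1⟩
  · obtain ⟨s, hs0, hs1, hx⟩ := hp.1.exists_isExtremalAt h.1 h.2
    rw [← hi]
    exact hx.isPerimeterMinimizer hp hs0 hs1
  · have hp' := (hmin p i hp hi).dist_eq
    have hq' := (hmin q j hq hj).dist_eq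
    rw [congruent_iff_dist_eq]
    intro a b
    -- The paths start at the end of the distinguished edge, hence the shift of the index by one.
    have key : ∀ i a : Fin 5, i + a = i + 1 + (a - 1) := by decide
    rw [key i a, key i b, key j a, key j b, hp', hq', hi, hj]
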